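/- \textbf{Theorem.} Let $\mathcal T$ be a simple quadrilateral tiling of a closed, connected, oriented surface of genus $g>0$, let $D$ be a division ring, and let $n\ge 0$ be an integer with $$n \ge \max_{v\in W(\mathcal T)} (\deg v) - 1,$$ where $W(\mathcal T)$ is the set of white vertices of $\mathcal T$. Then the incidence theorem in $\mathbb P^n(D)$ associated with $\mathcal T$ holds if and only if $D$ is commutative. Here the following definitions are used. Graphs embedded in surfaces are considered combinatorially: a finite graph embedded in a closed, connected, oriented surface with all faces open disks is given by its rotation system (the set of oriented edges, with the orientation-reversing involution and the permutation that lists the oriented edges leaving each vertex in counterclockwise order; this set is non-empty and the two permutations generate a transitive group). The genus $g$ is determined by $\#\text{vertices}-\#\text{edges}+\#\text{faces}=2-2g$. A \emph{quadrilateral tiling} is such an embedded graph in which the closure of each face (\emph{tile}) is an embedded quadrilateral, together with a colouring of the vertices black and white such that every edge joins vertices of different colours. It is \emph{simple} if no two distinct edges join the same pair of vertices. $\mathbb P^n(D)$ is the left projective space whose points are the one-dimensional left submodules of $D^{n+1}$; hyperplanes are the $n$-dimensional left submodules. A \emph{realization} of $\mathcal T$ in $\mathbb P^n(D)$ assigns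 a point to each black vertex and a hyperplane to each white vertex, such that for every edge the point and the hyperplane assigned to its endpoints are not incident. A tile with black vertices assigned the points $A_1,A_2$ and white vertices assigned the hyperplanes $\ell_1,\ell_2$ is \emph{coherent} if $A_1=A_2$, or $\ell_1=\ell_2$, or the line $A_1A_2$ meets $\ell_1\cap\ell_2$. The \emph{incidence theorem in $\mathbb P^n(D)$ associated with $\mathcal T$} is the statement that in every realization of $\mathcal T$ in $\mathbb P^n(D)$ in which all tiles except one are coherent, the remaining tile is coherent as well. -/

import Mathlib

universe u v

/-!
### Maps on surfaces

A finite graph cellularly embedded in a closed, connected, oriented surface, given by its rotation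
system.
-/

/-- A map (a finite graph, loops and multiple edges allowed, all of whose complementary regions are
open disks) on a closed, connected, oriented surface. `E` is the set of oriented edges. -/
structure SurfaceMap (E : Type u) where
  /-- The same edge with the opposite orientation. -/
  rev : Equiv.Perm E
  /-- The oriented edge that follows `e`, counterclockwise, among those with the same tail. -/
  rot : Equiv.Perm E
  rev_rev : ∀ e, rev (rev e) = e
  rev_ne : ∀ e, rev e ≠ e
  nonempty : Nonempty E
  connected : ∀ e e' : E, ∃ p ∈ Subgroup.closure {rev, rot}, p e = e'

namespace SurfaceMap

variable {E : Type u} (M : SurfaceMap E)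

/-- The oriented edge that follows `e` on the boundary of the face to the left of `e`: from the head
of `e`, take the edge preceding `rev e` in the counterclockwise order. -/
def next : Equiv.Perm E := M.rot⁻¹ * M.rev

/-- Vertices: cycles of the rotation. -/
def Vertex : Type u := Quotient (Equiv.Perm.SameCycle.setoid M.rot)

/-- Unoriented edges: pairs `{e, rev e}`. -/
def Edge : Type u := Quotient (Equiv.Perm.SameCycle.setoid M.rev)

/-- Faces: cycles of the boundary permutation. -/
def Face : Type u := Quotient (Equiv.Perm.SameCycle.setoid M.next)

/-- The tail of an oriented edge. -/
def tail (e : E) : M.Vertex := Quotient.mk _ e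

/-- The head of an oriented edge. -/
def head (e : E) : M.Vertex := M.tail (M.rev e)

/-- The face to the left of an oriented edge. -/
def leftFace (e : E) : M.Face := Quotient.mk _ e

/-- The degree of a vertex: the number of oriented edges that start there. -/
noncomputable def degree (x : M.Vertex) : ℕ := Nat.card {e : E // M.tail e = x}

/-- The number of sides of a face. -/
noncomputable def sides (f : M.Face) : ℕ := Nat.card {e : E // M.leftFace e = f}

/-- `x` is a vertex of the face `f`. -/
def IsVertexOf (x : M.Vertex) (f : M.Face) : Prop := ∃ e : E, M.tail e = x ∧ M.leftFace e = f

/-- The Euler characteristic `V - E + F` of the surface. -/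
noncomputable def eulerChar : ℤ :=
  (Nat.card M.Vertex : ℤ) - (Nat.card M.Edge : ℤ) + (Nat.card M.Face : ℤ)

/-- The surface has genus `g`. -/
def HasGenus (g : ℕ) : Prop := M.eulerChar = 2 - 2 * (g : ℤ)

/-- The map is a polygonal subdivision: the closure of every face is an embedded polygon (going
around the face, no vertex and no edge is met twice) with at least two vertices. -/
structure IsPolygonalSubdivision : Prop where
  vertex_inj : ∀ e e' : E, M.leftFace e = M.leftFace e' → M.tail e = M.tail e' → e = e'
  edge_inj : ∀ e : E, M.leftFace (M.rev e) ≠ M.leftFace e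
  two_le : ∀ f : M.Face, 2 ≤ M.sides f

end SurfaceMap

/-- A quadrilateral tiling: a polygonal subdivision of a closed, connected, oriented surface into
quadrilaterals, with vertices coloured black and white so that every edge joins vertices of
different colours. -/
structure QuadTiling (E : Type u) extends SurfaceMap E where
  subdivision : toSurfaceMap.IsPolygonalSubdivision
  four_sides : ∀ f : toSurfaceMap.Face, toSurfaceMap.sides f = 4
  /-- The set of black vertices; the other vertices are white. -/
  black : Set toSurfaceMap.Vertex
  bicolored : ∀ e : E, toSurfaceMap.tail e ∈ black ↔ toSurfaceMap.head e ∉ black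

/-!
### Points and hyperplanes

`ℙⁿ(D)` is the left projective space over the division ring `D`: its points are the
one-dimensional left submodules of `Dⁿ⁺¹`.
-/

/-- Points of the left projective space `ℙⁿ(D)`. -/
abbrev ProjPoint (D : Type v) [DivisionRing D] (n : ℕ) : Type v :=
  Projectivization D (Fin (n + 1) → D)

/-- Hyperplanes of `ℙⁿ(D)`: left submodules of `Dⁿ⁺¹` of dimension `n`. -/
def ProjHyperplane (D : Type v) [DivisionRing D] (n : ℕ) : Type v :=
  {H : Submodule D (Fin (n + 1) → D) // Module.finrank D H = n}

section Coherence

variable {D : Type v} [DivisionRing D] {n : ℕ}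

/-- The point `A` lies on the hyperplane `l`. -/
def ProjPoint.LiesOn (A : ProjPoint D n) (l : ProjHyperplane D n) : Prop :=
  A.submodule ≤ l.1

/-- Coherence of two points and two hyperplanes: the points coincide, or the hyperplanes coincide,
or the line through the points meets the intersection of the hyperplanes. -/
def Coherent (A₁ A₂ : ProjPoint D n) (l₁ l₂ : ProjHyperplane D n) : Prop :=
  A₁ = A₂ ∨ l₁ = l₂ ∨
    ∃ B : ProjPoint D n, B.submodule ≤ A₁.submodule ⊔ A₂.submodule ∧ B.LiesOn l₁ ∧ B.LiesOn l₂

end Coherence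

namespace QuadTiling

variable {E : Type u} (T : QuadTiling E)

/-- Black vertices. -/
def BlackVertex : Type u := {x : T.Vertex // x ∈ T.black}

/-- White vertices. -/
def WhiteVertex : Type u := {x : T.Vertex // x ∉ T.black}

/-- A tiling is simple if no two distinct edges join the same pair of vertices. -/
def IsSimple : Prop := ∀ e e' : E, T.tail e = T.tail e' → T.head e = T.head e' → e = e'

/-- A realization: a point for each black vertex and a hyperplane for each white vertex, not
incident whenever the two vertices are joined by an edge. -/
structure Realization (D : Type v) [DivisionRing D] (n : ℕ) where
  point : T.BlackVertex → ProjPoint D n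
  plane : T.WhiteVertex → ProjHyperplane D n
  not_incident : ∀ (e : E) (b : T.BlackVertex) (w : T.WhiteVertex),
    T.tail e = b.1 → T.head e = w.1 → ¬ (point b).LiesOn (plane w)

/-- The tile `t` is coherent: its two black vertices and its two white vertices give a coherent
quadruple. -/
def Realization.TileCoherent {T : QuadTiling E} {D : Type v} [DivisionRing D] {n : ℕ}
    (R : T.Realization D n) (t : T.Face) : Prop :=
  ∀ (b₁ b₂ : T.BlackVertex) (w₁ w₂ : T.WhiteVertex), b₁ ≠ b₂ → w₁ ≠ w₂ →
    T.IsVertexOf b₁.1 t → T.IsVertexOf b₂.1 t → T.IsVertexOf w₁.1 t → T.IsVertexOf w₂.1 t →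
    Coherent (R.point b₁) (R.point b₂) (R.plane w₁) (R.plane w₂)

/-- The incidence theorem in `ℙⁿ(D)` associated with `T`: in every realization in which all tiles
except one are coherent, the remaining tile is coherent. -/
def IncidenceTheorem (D : Type v) [DivisionRing D] (n : ℕ) : Prop :=
  ∀ (R : T.Realization D n) (t₀ : T.Face),
    (∀ t : T.Face, t ≠ t₀ → R.TileCoherent t) → R.TileCoherent t₀

end QuadTiling

/-!
Choose vectors spanning the points and functionals defining the hyperplanes of a realization. The
values of the functionals of white vertices at the vectors of adjacent black vertices, inverted when
the edge is traversed from white to black, label the oriented edges ("darts") by elements of `Dˣ`,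
so that reversing a dart inverts its label. A tile is coherent if and only if the holonomy around it,
the product of the labels along its boundary, is trivial
(`QuadTiling.Realization.IsLabelling.tileCoherent_iff`): both express the vanishing of a `2 × 2`
determinant over `D`.

If `D` is commutative, the product of all holonomies is the product of all labels, in which every
edge cancels; so a single holonomy cannot be non-trivial.

Conversely, let `D` be non-commutative, hence infinite by Wedderburn's theorem. As the tiling is
simple and the degrees of white vertices are at most `n + 1`, every labelling comes from a
realization: put the points in general position and interpolate the hyperplanes
(`QuadTiling.exists_realization_isLabelling`). It remains to find a labelling whose holonomy is
non-trivial around exactly one tile (`SurfaceMap.IsDisk.exists_isFlatExceptAt`). Starting from one face, delete edges that separate the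
growing face from a face not yet merged into it, until all faces have been merged into a disk.
A labelling of the remaining edges extends to the deleted ones so that each merged face has trivial
holonomy (`IsEdgeDeletion.exists_isFlatExceptAt`). So a labelling of the remaining graph is wanted
whose holonomy around the disk is non-trivial. If two edges `e`, `y` are interlaced along the
boundary `… e … y … e⁻¹ … y⁻¹ …` of the disk, label them by non-commuting elements and all others by `1`: the
holonomy is their commutator. If no two edges are interlaced, every remaining edge is a bridge
(`exists_side_or_interlaced`), so the remaining graph is acyclic and has fewer edges than vertices;
as the number of deleted edges is one less than the number of faces, the Euler characteristic is
at least `2`, which contradicts the assumption on the genus.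

Holonomy along a cycle of a permutation is handled through developing maps (`IsFlatAt`), so that no
words have to be manipulated.
-/

/-! ### Cycles of permutations -/

section PermCycles

variable {α : Type*}

/-- An equivalence relation linking every `x` to `f x` contains the orbit relation of `f`. -/
theorem Equiv.Perm.SameCycle.induction_equivalence {f : Equiv.Perm α} {r : α → α → Prop}
    (hr : Equivalence r) (h : ∀ x, r x (f x)) {x y : α} (hxy : f.SameCycle x y) : r x y := by
  obtain ⟨i, rfl⟩ := hxy
  induction i with
  | zero => exact hr.refl _
  | succ n ih =>
    rw [add_comm, zpow_add, zpow_one]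
    exact hr.trans ih (h _)
  | pred n ih =>
    refine hr.trans ih (hr.symm ?_)
    have := h ((f ^ (-(n : ℤ) - 1)) x)
    rwa [← Equiv.Perm.mul_apply, ← zpow_one_add, add_sub_cancel] at this

/-- A property preserved by `f` in both directions is constant on cycles. -/
theorem Equiv.Perm.SameCycle.iff_of_forall_iff {f : Equiv.Perm α} {p : α → Prop}
    (h : ∀ x, p x ↔ p (f x)) {x y : α} (hxy : f.SameCycle x y) : p x ↔ p y :=
  Equiv.Perm.SameCycle.induction_equivalence (r := fun x y => p x ↔ p y)
    ⟨fun _ => Iff.rfl, Iff.symm, Iff.trans⟩ h hxy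

theorem Equiv.Perm.pow_minimalPeriod_apply (f : Equiv.Perm α) (e : α) :
    (f ^ Function.minimalPeriod f e) e = e := by
  rw [← Equiv.Perm.iterate_eq_pow]
  exact Function.iterate_minimalPeriod

theorem Equiv.Perm.pow_apply_inj_of_lt {f : Equiv.Perm α} {e : α} {i j : ℕ}
    (hi : i < Function.minimalPeriod f e) (hj : j < Function.minimalPeriod f e)
    (h : (f ^ i) e = (f ^ j) e) : i = j := by
  rw [← Equiv.Perm.iterate_eq_pow, ← Equiv.Perm.iterate_eq_pow] at h
  exact Function.iterate_injOn_Iio_minimalPeriod hi hj h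

variable [Finite α]

/-- On a finite type, a property preserved by `f` propagates along cycles. -/
theorem Equiv.Perm.SameCycle.of_forall_imp {f : Equiv.Perm α} {p : α → Prop}
    (h : ∀ x, p x → p (f x)) {x y : α} (hxy : f.SameCycle x y) (hx : p x) : p y := by
  obtain ⟨i, rfl⟩ := hxy.exists_nat_pow_eq
  induction i with
  | zero => exact hx
  | succ n ih =>
    rw [pow_succ', Equiv.Perm.mul_apply]
    exact h _ (ih (by simp [Equiv.Perm.sameCycle_pow_right, Equiv.Perm.SameCycle.refl]))

/-- A property that holds at `f d` and propagates along `f` as long as `d` is not met holds on the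
whole cycle of `d`, except possibly at `d`. -/
theorem Equiv.Perm.SameCycle.of_forall_imp_of_ne {f : Equiv.Perm α} {p : α → Prop} {d x : α}
    (h0 : f d ≠ d → p (f d)) (h : ∀ x, f.SameCycle d x → x ≠ d → f x ≠ d → p x → p (f x))
    (hx : f.SameCycle d x) (hxd : x ≠ d) : p x := by
  obtain ⟨i, rfl⟩ := hx.exists_nat_pow_eq
  suffices H : ∀ i : ℕ, (f ^ i) d = d ∨ p ((f ^ i) d) from (H i).resolve_left hxd
  clear hxd hx i
  intro i
  induction i with
  | zero => simp
  | succ n ih =>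
    rw [pow_succ', Equiv.Perm.mul_apply]
    by_cases h1 : f ((f ^ n) d) = d
    · exact Or.inl h1
    · right
      by_cases h2 : (f ^ n) d = d
      · rw [h2] at h1 ⊢; exact h0 h1
      · exact h _ (by simp [Equiv.Perm.sameCycle_pow_right, Equiv.Perm.SameCycle.refl]) h2 h1
          (ih.resolve_left h2)

/-- Permutations that agree on the cycle of `d` under one of them have the same cycle there. -/
theorem Equiv.Perm.sameCycle_iff_of_eqOn {f g : Equiv.Perm α} {d : α}
    (h : ∀ x, f.SameCycle d x → f x = g x) (x : α) : f.SameCycle d x ↔ g.SameCycle d x := by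
  constructor
  · intro hx
    refine (Equiv.Perm.SameCycle.of_forall_imp
      (p := fun y => f.SameCycle d y ∧ g.SameCycle d y) ?_ hx ⟨.refl _ _, .refl _ _⟩).2
    rintro y ⟨h1, h2⟩
    exact ⟨Equiv.Perm.sameCycle_apply_right.2 h1,
      (h y h1).symm ▸ Equiv.Perm.sameCycle_apply_right.2 h2⟩
  · intro hx
    refine Equiv.Perm.SameCycle.of_forall_imp (p := fun y => f.SameCycle d y) ?_ hx (.refl _ _)
    intro y h1
    rw [← h y h1]
    exact Equiv.Perm.sameCycle_apply_right.2 h1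

theorem Equiv.Perm.minimalPeriod_pos (f : Equiv.Perm α) (e : α) :
    0 < Function.minimalPeriod f e :=
  Function.minimalPeriod_pos_of_mem_periodicPts (f.injective.mem_periodicPts e)

theorem Equiv.Perm.SameCycle.exists_lt_minimalPeriod {f : Equiv.Perm α} {e y : α}
    (hy : f.SameCycle e y) : ∃ i < Function.minimalPeriod f e, (f ^ i) e = y := by
  obtain ⟨i, rfl⟩ := hy.exists_nat_pow_eq
  refine ⟨i % Function.minimalPeriod f e, Nat.mod_lt _ (f.minimalPeriod_pos e), ?_⟩
  rw [← Equiv.Perm.iterate_eq_pow, ← Equiv.Perm.iterate_eq_pow]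
  exact Function.iterate_mod_minimalPeriod_eq

end PermCycles

/-! ### Flat labellings -/

section Flat

variable {E : Type u} {G : Type v} [Group G]

/-- The label `l` has trivial holonomy around the cycle of `x` under `f`, expressed by a developing
map: a function `h` on the cycle whose increments are the labels. -/
def IsFlatAt (f : Equiv.Perm E) (l : E → G) (x : E) : Prop :=
  ∃ h : E → G, ∀ y, f.SameCycle x y → h (f y) = h y * l y

/-- A developing map exists on any cycle cut open at one point `d`. -/
theorem exists_developing_of_ne [Finite E] (f : Equiv.Perm E) (l : E → G) (d : E) :
    ∃ h : E → G, ∀ y, f.SameCycle d y → y ≠ d → h (f y) = h y * l y := by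
  classical
  let P : ℕ → G := fun n => Nat.rec 1 (fun k g => g * l ((f ^ k) (f d))) n
  have hP : ∀ y, f.SameCycle d y → ∃ n : ℕ, (f ^ n) (f d) = y := fun y hy =>
    (Equiv.Perm.sameCycle_apply_left.2 hy).exists_nat_pow_eq
  refine ⟨fun y => if hy : ∃ n : ℕ, (f ^ n) (f d) = y then P (Nat.find hy) else 1, ?_⟩
  intro y hy hyd
  have h1 := hP y hy
  have h2 := hP (f y) (Equiv.Perm.sameCycle_apply_right.2 hy)
  simp only [dif_pos h1, dif_pos h2]
  -- The first passage at `f y` is one step after the first passage at `y`.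
  have key : Nat.find h2 = Nat.find h1 + 1 := by
    refine (Nat.find_eq_iff h2).2 ⟨?_, ?_⟩
    · rw [pow_succ', Equiv.Perm.mul_apply, Nat.find_spec h1]
    · intro m hm hmy
      rcases m with _ | k
      · exact hyd (f.injective hmy).symm
      · rw [pow_succ', Equiv.Perm.mul_apply] at hmy
        exact Nat.find_min h1 (Nat.succ_lt_succ_iff.1 hm) (f.injective hmy)
  rw [key]
  change P (Nat.find h1) * l ((f ^ Nat.find h1) (f d)) = _
  rw [Nat.find_spec h1]

end Flat

/-! ### Deleting an edge between two faces -/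

section DeleteEdge

variable {E : Type u}

/-- Face permutation `f'` obtained from the face permutation `f` of a map with edge involution `a`
by deleting the edge `{d, a d}`: where `f` would enter the edge, `f'` goes on along the other side
of the edge. The two sides of the deleted edge are left as a face of their own. -/
structure IsEdgeDeletion (a f f' : Equiv.Perm E) (d : E) : Prop where
  apply_left : f' d = a d
  apply_right : f' (a d) = d
  apply_of_ne : ∀ x, x ≠ d → x ≠ a d → f x ≠ d → f x ≠ a d → f' x = f x
  apply_of_eq_left : ∀ x, f x = d → f' x = f (a d)
  apply_of_eq_right : ∀ x, f x = a d → f' x = f d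

theorem exists_isEdgeDeletion (a f : Equiv.Perm E) {d : E} (h1 : f d ≠ d) (h2 : f (a d) ≠ a d)
    (h3 : a d ≠ d) : ∃ f', IsEdgeDeletion a f f' d := by
  classical
  have h6 : f d ≠ f (a d) := fun h => h3 (f.injective h).symm
  refine ⟨Equiv.swap d (f (a d)) * Equiv.swap (a d) (f d) * f, ?_, ?_, ?_, ?_, ?_⟩
  · rw [Equiv.Perm.mul_apply, Equiv.Perm.mul_apply, Equiv.swap_apply_right,
      Equiv.swap_apply_of_ne_of_ne h3 h2.symm]
  · rw [Equiv.Perm.mul_apply, Equiv.Perm.mul_apply, Equiv.swap_apply_of_ne_of_ne h2 h6.symm,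
      Equiv.swap_apply_right]
  · intro x hx hx' h h'
    rw [Equiv.Perm.mul_apply, Equiv.Perm.mul_apply,
      Equiv.swap_apply_of_ne_of_ne h' fun e => hx (f.injective e),
      Equiv.swap_apply_of_ne_of_ne h fun e => hx' (f.injective e)]
  · intro x hx
    rw [Equiv.Perm.mul_apply, Equiv.Perm.mul_apply, hx,
      Equiv.swap_apply_of_ne_of_ne h3.symm h1.symm, Equiv.swap_apply_left]
  · intro x hx
    rw [Equiv.Perm.mul_apply, Equiv.Perm.mul_apply, hx, Equiv.swap_apply_left,
      Equiv.swap_apply_of_ne_of_ne h1 h6]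

namespace IsEdgeDeletion

variable {a f f' : Equiv.Perm E} {d : E}

/-- Deleting an edge does not separate the other darts at a vertex. -/
theorem sameCycle_rot (h : IsEdgeDeletion a f f' d) (ha : ∀ x, a (a x) = x)
    (h1 : f d ≠ d) (h2 : f (a d) ≠ a d) (h3 : f d ≠ a d) (h4 : f (a d) ≠ d) {x y : E}
    (hxy : (a * f⁻¹).SameCycle x y) (hx : x ≠ d) (hx' : x ≠ a d) (hy : y ≠ d) (hy' : y ≠ a d) :
    (a * f'⁻¹).SameCycle x y := by
  classical
  -- `r` moves a deleted dart to its successor around the vertex.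
  let r : E → E := fun x => if x = d ∨ x = a d then a (f⁻¹ x) else x
  have hr : ∀ z, z ≠ d → z ≠ a d → r z = z := fun z h h' => if_neg (by tauto)
  have hσ : ∀ z, (a * f'⁻¹) (f' z) = a z := fun z => by simp
  suffices H : ∀ z, (a * f'⁻¹).SameCycle (r z) (r ((a * f⁻¹) z)) by
    have := Equiv.Perm.SameCycle.induction_equivalence
      (r := fun x y => (a * f'⁻¹).SameCycle (r x) (r y))
      ⟨fun _ => .refl _ _, .symm, .trans⟩ H hxy
    rwa [hr x hx hx', hr y hy hy'] at this
  intro w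
  obtain ⟨z, rfl⟩ := f.surjective w
  have hz : (a * f⁻¹) (f z) = a z := by simp
  rw [hz]
  have step : ∀ u v, f' z = u → a z = v → (a * f'⁻¹).SameCycle u v := by
    rintro u v rfl rfl
    rw [← hσ z]
    exact Equiv.Perm.sameCycle_apply_right.2 (.refl _ _)
  by_cases c1 : f z = d ∨ f z = a d
  · have e1 : r (f z) = a z := by simp [r, c1]
    have e2 : r (a z) = a z := by
      refine hr _ ?_ ?_
      · intro e
        have : z = a d := by rw [← e, ha]
        subst this
        exact c1.elim h4 h2
      · intro e
        have : z = d := a.injective e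
        subst this
        exact c1.elim h1 h3
    rw [e1, e2]
  · push Not at c1
    rw [hr _ c1.1 c1.2]
    by_cases c2 : a z = d
    · have hz' : z = a d := by rw [← c2, ha]
      have e2 : r (a z) = a (f⁻¹ d) := by simp [r, c2]
      have := h.apply_of_eq_left (f⁻¹ d) (by simp)
      have e3 : (a * f'⁻¹) (f (a d)) = a (f⁻¹ d) := by rw [← this]; exact hσ _
      rw [e2, hz', ← e3]
      exact Equiv.Perm.sameCycle_apply_right.2 (.refl _ _)
    · by_cases c3 : a z = a d
      · have hz' : z = d := a.injective c3
        have e2 : r (a z) = a (f⁻¹ (a d)) := by simp [r, c3]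
        have := h.apply_of_eq_right (f⁻¹ (a d)) (by simp)
        have e3 : (a * f'⁻¹) (f d) = a (f⁻¹ (a d)) := by rw [← this]; exact hσ _
        rw [e2, hz', ← e3]
        exact Equiv.Perm.sameCycle_apply_right.2 (.refl _ _)
      · rw [hr _ c2 c3]
        refine step _ _ (h.apply_of_ne z ?_ ?_ c1.1 c1.2) rfl
        · rintro rfl; exact c3 rfl
        · rintro rfl; exact c2 (ha d)

variable [Finite E]

/-- The darts of the two faces adjacent to a deleted edge, other than those of the edge, form a
single face after the deletion. -/
theorem sameCycle_iff (h : IsEdgeDeletion a f f' d)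
    (h1 : f d ≠ d) (h2 : f (a d) ≠ a d) (hne : ¬ f.SameCycle d (a d)) (x : E) :
    f'.SameCycle (f d) x ↔ (f.SameCycle d x ∨ f.SameCycle (a d) x) ∧ x ≠ d ∧ x ≠ a d := by
  have had : a d ≠ d := fun e => hne (by rw [e])
  have h3 : f d ≠ a d := fun e => hne (e ▸ Equiv.Perm.sameCycle_apply_right.2 (.refl _ _))
  have h4 : f (a d) ≠ d := fun e =>
    hne (Equiv.Perm.SameCycle.symm (by
      conv_rhs => rw [← e]
      exact Equiv.Perm.sameCycle_apply_right.2 (.refl _ _)))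
  have A : ∀ {z}, f.SameCycle d z → f.SameCycle d (f z) := Equiv.Perm.sameCycle_apply_right.2
  have B : ∀ {z}, f.SameCycle (a d) z → f.SameCycle (a d) (f z) :=
    Equiv.Perm.sameCycle_apply_right.2
  constructor
  · intro hx
    refine Equiv.Perm.SameCycle.of_forall_imp
      (p := fun x => (f.SameCycle d x ∨ f.SameCycle (a d) x) ∧ x ≠ d ∧ x ≠ a d) ?_ hx
      ⟨Or.inl (A (.refl _ _)), h1, h3⟩
    rintro y ⟨hy, hyd, hya⟩
    by_cases c1 : f y = d
    · rw [h.apply_of_eq_left y c1]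
      exact ⟨Or.inr (B (.refl _ _)), h4, h2⟩
    by_cases c2 : f y = a d
    · rw [h.apply_of_eq_right y c2]
      exact ⟨Or.inl (A (.refl _ _)), h1, h3⟩
    rw [h.apply_of_ne y hyd hya c1 c2]
    exact ⟨hy.imp A B, c1, c2⟩
  · rintro ⟨hx, hxd, hxa⟩
    have C : ∀ x, f.SameCycle d x → x ≠ d → f'.SameCycle (f d) x := by
      intro x hx hxd
      refine Equiv.Perm.SameCycle.of_forall_imp_of_ne (p := fun x => f'.SameCycle (f d) x)
        (fun _ => .refl _ _) ?_ hx hxd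
      intro y hy hyd hfy hp
      rw [← h.apply_of_ne y hyd (fun e => hne (e ▸ hy)) hfy (fun e => hne (e ▸ A hy))]
      exact Equiv.Perm.sameCycle_apply_right.2 hp
    have C' : f'.SameCycle (f d) (f (a d)) := by
      have e : f (f⁻¹ d) = d := by simp
      rw [← h.apply_of_eq_left _ e]
      refine Equiv.Perm.sameCycle_apply_right.2 (C _ (Equiv.Perm.sameCycle_apply_right.1 ?_) ?_)
      · rw [e]
      · intro e'; rw [e'] at e; exact h1 e
    rcases hx with hx | hx
    · exact C x hx hxd
    · refine Equiv.Perm.SameCycle.of_forall_imp_of_ne (p := fun x => f'.SameCycle (f d) x)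
        (fun _ => C') ?_ hx hxa
      intro y hy hya hfy hp
      have N : ∀ z, f.SameCycle (a d) z → z ≠ d := fun z hz e => hne (e ▸ hz).symm
      rw [← h.apply_of_ne y (N y hy) hya (N _ (B hy)) hfy]
      exact Equiv.Perm.sameCycle_apply_right.2 hp

end IsEdgeDeletion

end DeleteEdge

section DeleteFlat

variable {E : Type u} {G : Type v} [Group G]

/-- `l` has trivial holonomy around every face except the one of `x`, where it does not. -/
structure IsFlatExceptAt (a f : Equiv.Perm E) (l : E → G) (x : E) : Prop where
  map_inv : ∀ y, l (a y) = (l y)⁻¹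
  not_flat : ¬ IsFlatAt f l x
  flat : ∀ y, ¬ f.SameCycle x y → IsFlatAt f l y

/-- A labelling that is flat except at one face lifts along the deletion of an edge of that face:
the label of the deleted edge is chosen so that the face of `d` becomes flat, and the two adjacent
faces cannot both be flat because their developing maps would glue. -/
theorem IsEdgeDeletion.exists_isFlatExceptAt [Finite E] {a f f' : Equiv.Perm E} {d : E}
    (h : IsEdgeDeletion a f f' d) (ha : ∀ x, a (a x) = x)
    (h1 : f d ≠ d) (h2 : f (a d) ≠ a d) (hne : ¬ f.SameCycle d (a d)) {l' : E → G}
    (hl : IsFlatExceptAt a f' l' (f d)) : ∃ l : E → G, IsFlatExceptAt a f l (a d) := by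
  classical
  have had : a d ≠ d := fun e => hne (by rw [e])
  have A : ∀ {w z}, f.SameCycle w z → f.SameCycle w (f z) := Equiv.Perm.sameCycle_apply_right.2
  have A' : ∀ {w z}, f.SameCycle w (f z) → f.SameCycle w z := Equiv.Perm.sameCycle_apply_right.1
  obtain ⟨h₁, hh₁⟩ := exists_developing_of_ne f l' d
  set g : G := (h₁ d)⁻¹ * h₁ (f d) with hg
  set l : E → G := fun y => if y = d then g else if y = a d then g⁻¹ else l' y with hldef
  have ld : l d = g := if_pos rfl
  have la : l (a d) = g⁻¹ := by simp [hldef, had]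
  have lo : ∀ y, y ≠ d → y ≠ a d → l y = l' y := fun y e e' => by simp [hldef, e, e']
  have D1 : ∀ y, f.SameCycle d y → h₁ (f y) = h₁ y * l y := by
    intro y hy
    by_cases e : y = d
    · rw [e, ld, hg]; group
    · rw [hh₁ y hy e, lo y e fun e' => hne (e' ▸ hy)]
  refine ⟨l, ?_, ?_, ?_⟩
  · intro y
    by_cases e : y = d
    · rw [e, la, ld]
    by_cases e' : y = a d
    · rw [e', ha, la, ld, inv_inv]
    have f1 : a y ≠ d := fun e'' => e' (by rw [← e'', ha])
    have f2 : a y ≠ a d := fun e'' => e (a.injective e'')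
    rw [lo _ f1 f2, lo _ e e', hl.map_inv]
  · rintro ⟨h₂, hh₂⟩
    refine hl.not_flat ⟨fun y => if f.SameCycle (a d) y then h₂ y
      else h₂ (a d) * g⁻¹ * (h₁ d)⁻¹ * h₁ y, ?_⟩
    intro y hy
    obtain ⟨hy, hyd, hya⟩ := (h.sameCycle_iff h1 h2 hne y).1 hy
    have N : ∀ z, f.SameCycle d z → ¬ f.SameCycle (a d) z := fun z hz hz' => hne (hz.trans hz'.symm)
    by_cases c1 : f y = d
    · have hyd' : f.SameCycle d y := A' (by rw [c1])
      rw [h.apply_of_eq_left y c1]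
      simp only [if_pos (A (.refl f (a d))), if_neg (N y hyd')]
      rw [hh₂ _ (.refl _ _), la, mul_assoc _ (h₁ y), ← lo y hyd hya, ← D1 y hyd', c1]
      group
    by_cases c2 : f y = a d
    · have hya' : f.SameCycle (a d) y := A' (by rw [c2])
      rw [h.apply_of_eq_right y c2]
      simp only [if_neg (N (f d) (A (.refl _ _))), if_pos hya']
      rw [← lo y hyd hya, ← hh₂ y hya', c2, D1 d (.refl _ _), ld]
      group
    rw [h.apply_of_ne y hyd hya c1 c2, ← lo y hyd hya]
    rcases hy with hy | hy
    · simp only [if_neg (N y hy), if_neg (N _ (A hy))]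
      rw [D1 y hy]; group
    · simp only [if_pos hy, if_pos (A hy)]
      exact hh₂ y hy
  · intro y hy
    by_cases c : f.SameCycle d y
    · exact ⟨h₁, fun z hz => D1 z (c.trans hz)⟩
    have key : ∀ z, f.SameCycle y z → z ≠ d ∧ z ≠ a d := fun z hz =>
      ⟨fun e => c (e ▸ hz.symm), fun e => hy (e ▸ hz.symm)⟩
    have agree : ∀ z, f.SameCycle y z → f z = f' z := fun z hz =>
      (h.apply_of_ne z (key z hz).1 (key z hz).2 (key _ (A hz)).1 (key _ (A hz)).2).symm
    obtain ⟨k, hk⟩ := hl.flat y fun hc =>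
      ((h.sameCycle_iff h1 h2 hne y).1 hc).1.elim c hy
    refine ⟨k, fun z hz => ?_⟩
    rw [agree z hz, lo z (key z hz).1 (key z hz).2]
    exact hk z ((Equiv.Perm.sameCycle_iff_of_eqOn agree z).1 hz)

end DeleteFlat

/-! ### Interlaced edges of a one-face map -/

section Interlaced

variable {E : Type u} {G : Type v} [Group G]

/-- If `e` and `y` are interlaced along a cycle, so that it reads `e … y … e⁻¹ … y⁻¹ …`, then
labelling them by `p` and `q`, and everything else trivially, makes the holonomy the commutator of
`p` and `q`. -/
theorem not_isFlatAt_of_interlaced {f : Equiv.Perm E} {l : E → G} {e : E} {p q : G}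
    {i j k n : ℕ} (hi : 0 < i) (hij : i < j) (hjk : j < k) (hkn : k < n) (hn : (f ^ n) e = e)
    (h0 : l e = p) (h1 : l ((f ^ i) e) = q) (h2 : l ((f ^ j) e) = p⁻¹) (h3 : l ((f ^ k) e) = q⁻¹)
    (h4 : ∀ m < n, m ≠ 0 → m ≠ i → m ≠ j → m ≠ k → l ((f ^ m) e) = 1) (hpq : p * q ≠ q * p) :
    ¬ IsFlatAt f l e := by
  rintro ⟨h, hh⟩
  have step : ∀ m, h ((f ^ (m + 1)) e) = h ((f ^ m) e) * l ((f ^ m) e) := by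
    intro m
    rw [pow_succ', Equiv.Perm.mul_apply]
    exact hh _ (by simp [Equiv.Perm.sameCycle_pow_right, Equiv.Perm.SameCycle.refl])
  have const : ∀ s t, s ≤ t → (∀ m, s ≤ m → m < t → l ((f ^ m) e) = 1) →
      h ((f ^ t) e) = h ((f ^ s) e) := by
    intro s t hst
    induction t, hst using Nat.le_induction with
    | base => intro _; rfl
    | succ t hst ih =>
      intro hl
      rw [step, hl t hst (Nat.lt_succ_self t), mul_one,
        ih fun m h1 h2 => hl m h1 (Nat.lt_succ_of_lt h2)]
  have c1 := const 1 i hi fun m _ _ => h4 m (by omega) (by omega) (by omega) (by omega) (by omega)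
  have c2 := const (i + 1) j hij
    fun m _ _ => h4 m (by omega) (by omega) (by omega) (by omega) (by omega)
  have c3 := const (j + 1) k hjk
    fun m _ _ => h4 m (by omega) (by omega) (by omega) (by omega) (by omega)
  have c4 := const (k + 1) n hkn
    fun m _ _ => h4 m (by omega) (by omega) (by omega) (by omega) (by omega)
  have s0 : h ((f ^ 1) e) = h e * p := by simpa [h0] using step 0
  rw [step, h1, c1, s0] at c2
  rw [step, h2, c2] at c3
  rw [step, h3, c3, hn] at c4
  apply hpq
  have : p * q * p⁻¹ * q⁻¹ = 1 := by
    have c5 : h e * (p * q * p⁻¹ * q⁻¹) = h e * 1 := by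
      rw [mul_one]; conv_rhs => rw [c4]
      group
    exact mul_left_cancel c5
  have := congrArg (· * (q * p)) this
  simpa [mul_assoc] using this

/-- Let the cycle of `e` under `f` be closed under the edge involution `a`. If no edge is interlaced
with `e`, the darts from `e` (excluded) to `a e` (included) are closed under the rotation
`a * f⁻¹`, and those other than `a e` are closed under `a`: they form the part of the graph on one
side of the bridge `e`. Otherwise two interlaced edges carry a labelling that is not flat. -/
theorem exists_side_or_interlaced [Finite E] {a f : Equiv.Perm E} (ha : ∀ x, a (a x) = x)
    (ha' : ∀ x, a x ≠ x) {e : E} (hc : ∀ y, f.SameCycle e y → f.SameCycle e (a y)) {p q : G}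
    (hpq : p * q ≠ q * p) :
    (∃ U : Set E, e ∉ U ∧ a e ∈ U ∧ (∀ y ∈ U, (a * f⁻¹) y ∈ U) ∧ ∀ y ∈ U, y ≠ a e → a y ∈ U) ∨
      ∃ l : E → G, (∀ y, l (a y) = (l y)⁻¹) ∧ (∀ y, ¬ f.SameCycle e y → l y = 1) ∧
        ¬ IsFlatAt f l e := by
  classical
  set n := Function.minimalPeriod f e with hndef
  have hn0 : 0 < n := f.minimalPeriod_pos e
  have hn : (f ^ n) e = e := f.pow_minimalPeriod_apply e
  have inj : ∀ i < n, ∀ j < n, (f ^ i) e = (f ^ j) e → i = j := fun _ hi _ hj =>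
    Equiv.Perm.pow_apply_inj_of_lt hi hj
  have surj : ∀ y, f.SameCycle e y → ∃ i < n, (f ^ i) e = y := fun _ hy =>
    hy.exists_lt_minimalPeriod
  have cyc : ∀ i : ℕ, f.SameCycle e ((f ^ i) e) := fun i => ⟨i, by simp⟩
  obtain ⟨j, hj, hje⟩ := surj (a e) (hc _ (.refl _ _))
  have hj0 : j ≠ 0 := by
    rintro rfl
    exact ha' e (by simpa using hje.symm)
  by_cases H : ∀ i, 0 < i → i < j → ∃ i', 0 < i' ∧ i' < j ∧ (f ^ i') e = a ((f ^ i) e)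
  · left
    refine ⟨{y | ∃ i, 0 < i ∧ i ≤ j ∧ (f ^ i) e = y}, ?_, ⟨j, by omega, le_rfl, hje⟩, ?_, ?_⟩
    · rintro ⟨i, h0, h1, h2⟩
      have := inj i (by omega) 0 hn0 (by simpa using h2)
      omega
    · rintro _ ⟨i, h0, h1, rfl⟩
      obtain ⟨m, rfl⟩ : ∃ m, i = m + 1 := ⟨i - 1, by omega⟩
      have e1 : (a * f⁻¹) ((f ^ (m + 1)) e) = a ((f ^ m) e) := by
        rw [pow_succ']; simp
      rw [e1]
      by_cases hm : m = 0
      · subst hm; exact ⟨j, by omega, le_rfl, by simpa using hje⟩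
      · obtain ⟨i', h2, h3, h4⟩ := H m (by omega) (by omega)
        exact ⟨i', h2, h3.le, h4⟩
    · rintro _ ⟨i, h0, h1, rfl⟩ hne
      have : i ≠ j := by rintro rfl; exact hne hje
      obtain ⟨i', h2, h3, h4⟩ := H i h0 (by omega)
      exact ⟨i', h2, h3.le, h4⟩
  · right
    push Not at H
    obtain ⟨i, hi, hij, Hi⟩ := H
    obtain ⟨k, hk, hke⟩ := surj _ (hc _ (cyc i))
    have hk0 : k ≠ 0 := by
      rintro rfl
      have : (f ^ i) e = a e := by
        have : a e = a (a ((f ^ i) e)) := congrArg a (by simpa using hke)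
        rw [this, ha]
      have := inj i (by omega) j hj (this.trans hje.symm)
      omega
    have hkj : k ≠ j := by
      rintro rfl
      have := inj i (by omega) 0 hn0 (a.injective (by rw [← hke, hje]; simp))
      omega
    have hjk : j < k := by
      by_contra hcon
      exact Hi k (by omega) (by omega) hke
    set y := (f ^ i) e with hy
    have d1 : y ≠ e := fun h => hi.ne' (inj i (by omega) 0 hn0 (by simpa using h))
    have d2 : y ≠ a e := fun h => hij.ne (inj i (by omega) j hj (by rw [hje]; exact h))
    have d3 : a y ≠ e := fun h => d2 (by rw [← h, ha])
    have d4 : a y ≠ a e := fun h => d1 (a.injective h)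
    let l : E → G := fun z => if z = e then p else if z = a e then p⁻¹ else
      if z = y then q else if z = a y then q⁻¹ else 1
    have l1 : l e = p := if_pos rfl
    have l2 : l (a e) = p⁻¹ := by simp [l, ha' e]
    have l3 : l y = q := by simp [l, d1, d2]
    have l4 : l (a y) = q⁻¹ := by simp [l, d3, ha' y, d1]
    have l5 : ∀ z, z ≠ e → z ≠ a e → z ≠ y → z ≠ a y → l z = 1 := by
      intro z h1 h2 h3 h4; simp [l, h1, h2, h3, h4]
    refine ⟨l, ?_, ?_, not_isFlatAt_of_interlaced hi hij hjk hk hn l1 l3 (by rw [hje, l2])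
      (by rw [hke, l4]) ?_ hpq⟩
    · intro z
      by_cases h1 : z = e
      · rw [h1, l1, l2]
      by_cases h2 : z = a e
      · rw [h2, ha, l1, l2, inv_inv]
      by_cases h3 : z = y
      · rw [h3, l3, l4]
      by_cases h4 : z = a y
      · rw [h4, ha, l3, l4, inv_inv]
      rw [l5 z h1 h2 h3 h4, l5 (a z), inv_one]
      · intro h; exact h2 (by rw [← h, ha])
      · intro h; exact h1 (a.injective h)
      · intro h; exact h4 (by rw [← h, ha])
      · intro h; exact h3 (a.injective h)
    · intro z hz
      apply l5 z <;> rintro rfl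
      · exact hz (.refl _ _)
      · exact hz (hc _ (.refl _ _))
      · exact hz (cyc i)
      · exact hz (hc _ (cyc i))
    · intro m hm m0 mi mj mk
      apply l5
      · exact fun h => m0 (inj m hm 0 hn0 (by simpa using h))
      · exact fun h => mj (inj m hm j hj (h.trans hje.symm))
      · exact fun h => mi (inj m hm i (by omega) h)
      · exact fun h => mk (inj m hm k hk (h.trans hke.symm))

end Interlaced

/-! ### Merging the faces of a map along a dual tree -/

namespace SurfaceMap

variable {E : Type u} {M : SurfaceMap E}

theorem tail_eq_iff {e e' : E} : M.tail e = M.tail e' ↔ M.rot.SameCycle e e' :=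
  Quotient.eq

theorem leftFace_eq_iff {e e' : E} : M.leftFace e = M.leftFace e' ↔ M.next.SameCycle e e' :=
  Quotient.eq

theorem tail_next (e : E) : M.tail (M.next e) = M.head e := by
  refine tail_eq_iff.2 ?_
  change M.rot.SameCycle (M.rot⁻¹ (M.rev e)) (M.rev e)
  rw [← Equiv.Perm.sameCycle_apply_left]
  simp [Equiv.Perm.SameCycle.refl]

/-- The state of the growth of a disk from one face of `M`: the edges whose darts form `R` have been
deleted, each of them separating the growing face from a face not yet merged into it. `f` is
the resulting face permutation, the growing face is the `f`-cycle of `x`, and `A` is the set of faces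
of `M` merged into it. -/
structure IsDisk (M : SurfaceMap E) (R : Finset E) (f : Equiv.Perm E) (x : E)
    (A : Finset M.Face) : Prop where
  rev_mem : ∀ y, M.rev y ∈ R ↔ y ∈ R
  base_notMem : x ∉ R
  apply_of_mem : ∀ y ∈ R, f y = M.rev y
  sameCycle_rot : ∀ y z, y ∉ R → z ∉ R → M.rot.SameCycle y z → (M.rev * f⁻¹).SameCycle y z
  tail_apply : ∀ y, M.tail (f y) = M.head y
  apply_of_outside : ∀ y, y ∉ R → ¬ f.SameCycle x y → f y = M.next y
  card_faces : 2 * A.card = R.card + 2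
  mem_faces : ∀ y, M.leftFace y ∈ A ↔ y ∈ R ∨ f.SameCycle x y

theorem isDisk_next (M : SurfaceMap E) (x : E) : M.IsDisk ∅ M.next x {M.leftFace x} where
  rev_mem := by simp
  base_notMem := by simp
  apply_of_mem := by simp
  sameCycle_rot := by
    intro y z _ _ h
    have : M.rev * M.next⁻¹ = M.rot := by simp [next]
    rwa [this]
  tail_apply := tail_next
  apply_of_outside := fun _ _ _ => rfl
  card_faces := by simp
  mem_faces := by
    intro y
    simp [leftFace_eq_iff, Equiv.Perm.sameCycle_comm]

namespace IsDisk

variable {R : Finset E} {f : Equiv.Perm E} {x : E} {A : Finset M.Face}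

theorem apply_mem_iff (h : M.IsDisk R f x A) (y : E) : f y ∈ R ↔ y ∈ R := by
  constructor
  · intro hy
    have : f (M.rev (f y)) = f y := by
      rw [h.apply_of_mem _ ((h.rev_mem _).2 hy), M.rev_rev]
    rw [← f.injective this]
    exact (h.rev_mem _).2 hy
  · intro hy
    rw [h.apply_of_mem y hy]
    exact (h.rev_mem y).2 hy

theorem notMem_of_sameCycle (h : M.IsDisk R f x A) {y : E} (hy : f.SameCycle x y) : y ∉ R :=
  (hy.iff_of_forall_iff (p := fun y => y ∉ R) fun z => not_congr (h.apply_mem_iff z).symm).1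
    h.base_notMem

variable [Finite E]

/-- One step of the growth: the edge of `d` is deleted and the face of `d` is merged into the growing
face. A labelling that is flat except at the growing face lifts back. -/
theorem exists_step (h : M.IsDisk R f x A) (hloop : ∀ e, M.tail e ≠ M.head e) {d : E}
    (hd' : f.SameCycle x (M.rev d)) (hd : ¬ f.SameCycle x d) {G : Type v} [Group G] :
    ∃ R' f' x' A', M.IsDisk R' f' x' A' ∧ R.card < R'.card ∧
      ((∃ l : E → G, IsFlatExceptAt M.rev f' l x') → ∃ l : E → G, IsFlatExceptAt M.rev f l x) := by
  classical
  have h1 : ∀ y, f y ≠ y := fun y e => hloop y (by rw [← h.tail_apply, e])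
  have hne : ¬ f.SameCycle d (M.rev d) := fun e => hd (hd'.trans e.symm)
  have A1 : ∀ {w z}, f.SameCycle w z → f.SameCycle w (f z) := Equiv.Perm.sameCycle_apply_right.2
  have A2 : ∀ {w z}, f.SameCycle w (f z) → f.SameCycle w z := Equiv.Perm.sameCycle_apply_right.1
  have h3 : f d ≠ M.rev d := fun e => hne (e ▸ A1 (.refl _ _))
  have h4 : f (M.rev d) ≠ d := fun e => hd (e ▸ A1 hd')
  obtain ⟨f', hf'⟩ := exists_isEdgeDeletion M.rev f (h1 d) (h1 (M.rev d)) (M.rev_ne d)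
  have hcyc := hf'.sameCycle_iff (h1 d) (h1 _) hne
  have hdR' : M.rev d ∉ R := h.notMem_of_sameCycle hd'
  have hdR : d ∉ R := fun e => hdR' ((h.rev_mem d).2 e)
  -- The face of `d` has not been touched so far.
  have out : ∀ y, f.SameCycle d y → y ∉ R ∧ ¬ f.SameCycle x y := fun y hy =>
    ⟨fun e => hdR ((hy.iff_of_forall_iff (p := fun y => y ∈ R)
      fun z => (h.apply_mem_iff z).symm).2 e), fun e => hd (e.trans hy.symm)⟩
  have face : ∀ y, f.SameCycle d y ↔ M.next.SameCycle d y := Equiv.Perm.sameCycle_iff_of_eqOn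
    fun y hy => h.apply_of_outside y (out y hy).1 (out y hy).2
  refine ⟨insert d (insert (M.rev d) R), f', f d, insert (M.leftFace d) A, ?_, ?_, ?_⟩
  · constructor
    · intro y
      have e1 : M.rev y = d ↔ y = M.rev d :=
        ⟨fun e => by rw [← e, M.rev_rev], fun e => by rw [e, M.rev_rev]⟩
      simp only [Finset.mem_insert, h.rev_mem, e1, M.rev.injective.eq_iff]
      tauto
    · simp only [Finset.mem_insert, not_or]
      exact ⟨h1 d, h3, (out _ (A1 (.refl _ _))).1⟩
    · intro y hy
      simp only [Finset.mem_insert] at hy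
      rcases hy with rfl | rfl | hy
      · exact hf'.apply_left
      · rw [hf'.apply_right, M.rev_rev]
      · have e1 : f y ∈ R := (h.apply_mem_iff y).2 hy
        rw [hf'.apply_of_ne y (fun e => hdR (e ▸ hy)) (fun e => hdR' (e ▸ hy))
          (fun e => hdR (e ▸ e1)) (fun e => hdR' (e ▸ e1)), h.apply_of_mem y hy]
    · intro y z hy hz hyz
      simp only [Finset.mem_insert, not_or] at hy hz
      exact hf'.sameCycle_rot M.rev_rev (h1 d) (h1 _) h3 h4
        (h.sameCycle_rot y z hy.2.2 hz.2.2 hyz) hy.1 hy.2.1 hz.1 hz.2.1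
    · intro y
      by_cases c1 : f y = d
      · rw [hf'.apply_of_eq_left y c1, h.tail_apply, ← h.tail_apply y, c1, head, M.rev_rev]
      by_cases c2 : f y = M.rev d
      · rw [hf'.apply_of_eq_right y c2, h.tail_apply, ← h.tail_apply y, c2, head]
      by_cases c3 : y = d
      · rw [c3, hf'.apply_left]; rfl
      by_cases c4 : y = M.rev d
      · rw [c4, hf'.apply_right, head, M.rev_rev]
      rw [hf'.apply_of_ne y c3 c4 c1 c2, h.tail_apply]
    · intro y hy hxy
      simp only [Finset.mem_insert, not_or] at hy
      rw [hcyc] at hxy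
      have e1 : ¬ f.SameCycle d y := fun e => hxy ⟨Or.inl e, hy.1, hy.2.1⟩
      have e2 : ¬ f.SameCycle (M.rev d) y := fun e => hxy ⟨Or.inr e, hy.1, hy.2.1⟩
      rw [hf'.apply_of_ne y hy.1 hy.2.1, h.apply_of_outside y hy.2.2 fun e => e2 (hd'.symm.trans e)]
      · exact fun e => e1 (A2 (e ▸ .refl _ _))
      · exact fun e => e2 (A2 (e ▸ .refl _ _))
    · rw [Finset.card_insert_of_notMem, Finset.card_insert_of_notMem,
        Finset.card_insert_of_notMem hdR']
      · have := h.card_faces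
        omega
      · simp only [Finset.mem_insert, not_or]
        exact ⟨(M.rev_ne d).symm, hdR⟩
      · rw [h.mem_faces]
        tauto
    · intro y
      rw [Finset.mem_insert, h.mem_faces, hcyc, leftFace_eq_iff,
        Equiv.Perm.sameCycle_comm, ← face]
      simp only [Finset.mem_insert]
      have e1 : f.SameCycle x y ↔ f.SameCycle (M.rev d) y :=
        ⟨fun e => hd'.symm.trans e, fun e => hd'.trans e⟩
      have e2 : y = d → f.SameCycle d y := fun e => e ▸ .refl _ _
      have e3 : y = M.rev d → f.SameCycle (M.rev d) y := fun e => e ▸ .refl _ _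
      rw [e1]
      tauto
  · rw [Finset.card_insert_of_notMem, Finset.card_insert_of_notMem hdR']
    · omega
    · simp only [Finset.mem_insert, not_or]
      exact ⟨(M.rev_ne d).symm, hdR⟩
  · rintro ⟨l', hl'⟩
    obtain ⟨l, hl⟩ := hf'.exists_isFlatExceptAt M.rev_rev (h1 d) (h1 _) hne hl'
    refine ⟨l, hl.map_inv, ?_, fun y hy => hl.flat y fun e => hy (hd'.trans e)⟩
    rintro ⟨k, hk⟩
    exact hl.not_flat ⟨k, fun y hy => hk y (hd'.trans hy)⟩

/-- When both sides of every edge of the growing face lie on this face, it has swallowed the whole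
surface. -/
theorem mem_or_sameCycle (h : M.IsDisk R f x A)
    (hc : ∀ y, f.SameCycle x y → f.SameCycle x (M.rev y)) (y : E) : y ∈ R ∨ f.SameCycle x y := by
  have hrev : ∀ y, (y ∈ R ∨ f.SameCycle x y) → (M.rev y ∈ R ∨ f.SameCycle x (M.rev y)) :=
    fun y hy => hy.imp (h.rev_mem y).2 (hc y)
  have hnext : ∀ y, ¬ (y ∈ R ∨ f.SameCycle x y) →
      ¬ (M.next y ∈ R ∨ f.SameCycle x (M.next y)) := by
    intro y hy
    rw [not_or] at hy
    rw [← h.apply_of_outside y hy.1 hy.2, h.apply_mem_iff, Equiv.Perm.sameCycle_apply_right]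
    tauto
  have hrot : ∀ y, (y ∈ R ∨ f.SameCycle x y) → (M.rot y ∈ R ∨ f.SameCycle x (M.rot y)) := by
    intro y hy
    by_contra hcon
    have e1 : ¬ (M.rev (M.rot y) ∈ R ∨ f.SameCycle x (M.rev (M.rot y))) := by
      intro e
      have := hrev _ e
      rw [M.rev_rev] at this
      exact hcon this
    have e2 : M.next (M.rev (M.rot y)) = y := by simp [next, M.rev_rev]
    exact hnext _ e1 (e2.symm ▸ hy)
  obtain ⟨p, hp, rfl⟩ := M.connected x y
  suffices H : ∀ z, (z ∈ R ∨ f.SameCycle x z) ↔ (p z ∈ R ∨ f.SameCycle x (p z)) from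
    (H x).1 (Or.inr (.refl _ _))
  induction hp using Subgroup.closure_induction with
  | mem q hq =>
    have hback : ∀ g : Equiv.Perm E, (∀ y, (y ∈ R ∨ f.SameCycle x y) →
        (g y ∈ R ∨ f.SameCycle x (g y))) → ∀ z, (z ∈ R ∨ f.SameCycle x z) ↔
          (g z ∈ R ∨ f.SameCycle x (g z)) := by
      intro g hg z
      refine ⟨hg z, fun hz => ?_⟩
      exact Equiv.Perm.SameCycle.of_forall_imp (p := fun y => y ∈ R ∨ f.SameCycle x y) hg
        (Equiv.Perm.sameCycle_apply_left.2 (.refl _ _)) hz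
    rcases hq with rfl | rfl
    · exact hback _ hrev
    · exact hback _ hrot
  | one => intro z; rfl
  | mul q r _ _ hq hr => intro z; exact (hr z).trans (hq (r z))
  | inv q _ hq =>
    intro z
    have := hq (q⁻¹ z)
    simpa using this.symm

end IsDisk

/-! ### Counting the vertices of a map without interlaced edges -/

theorem two_mul_card_edge_le [Finite E] (M : SurfaceMap E) :
    2 * Nat.card M.Edge ≤ Nat.card E := by
  have key : ∀ q : M.Edge, (Quotient.mk _ (M.rev q.out) : M.Edge) = q := by
    intro q
    conv_rhs => rw [← Quotient.out_eq q]
    exact Quotient.sound (Equiv.Perm.sameCycle_apply_left.2 (.refl _ _))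
  let F : M.Edge × Bool → E := fun q => if q.2 then q.1.out else M.rev q.1.out
  have hF : ∀ q, (Quotient.mk _ (F q) : M.Edge) = q.1 := by
    rintro ⟨q, b⟩
    cases b
    · exact key q
    · exact Quotient.out_eq q
  have inj : Function.Injective F := by
    rintro ⟨q, b⟩ ⟨q', b'⟩ h
    have e : q = q' := (hF (q, b)).symm.trans ((congrArg (Quotient.mk _) h).trans (hF (q', b')))
    subst e
    cases b <;> cases b'
    · rfl
    · exact (M.rev_ne q.out h).elim
    · exact (M.rev_ne q.out h.symm).elim
    · rfl
  have := Nat.card_le_card_of_injective F inj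
  rw [Nat.card_prod, Nat.card_eq_fintype_card (α := Bool), Fintype.card_bool] at this
  omega

/-- The simple graph on the vertices of `M` formed by the edges with no dart in `R`. -/
def remainingGraph (M : SurfaceMap E) (hloop : ∀ e, M.tail e ≠ M.head e) {R : Finset E}
    (hR : ∀ y, M.rev y ∈ R ↔ y ∈ R) : SimpleGraph M.Vertex where
  Adj p q := ∃ e, e ∉ R ∧ M.tail e = p ∧ M.head e = q
  symm := ⟨by
    rintro p q ⟨e, he, rfl, rfl⟩
    exact ⟨M.rev e, by rwa [hR], rfl, by rw [head, M.rev_rev]⟩⟩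
  loopless := ⟨by
    rintro p ⟨e, -, rfl, h⟩
    exact hloop e h.symm⟩

/-- An acyclic simple graph has fewer edges than vertices. -/
theorem _root_.SimpleGraph.IsAcyclic.card_edgeFinset_lt {V : Type*} [Fintype V] [Nonempty V]
    {H : SimpleGraph V} [Fintype H.edgeSet] (hH : H.IsAcyclic) :
    H.edgeFinset.card < Fintype.card V := by
  classical
  obtain ⟨T, hHT, -, hT⟩ :=
    SimpleGraph.connected_top.exists_isTree_le_of_le_of_isAcyclic le_top hH
  have h1 := hT.card_edgeFinset
  have h2 := Finset.card_le_card (SimpleGraph.edgeFinset_mono hHT)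
  omega

theorem card_lt_card_vertex_of_isAcyclic [Finite E] (hloop : ∀ e, M.tail e ≠ M.head e)
    (hsimple : ∀ e e', M.tail e = M.tail e' → M.head e = M.head e' → e = e')
    {R : Finset E} (hR : ∀ y, M.rev y ∈ R ↔ y ∈ R)
    (hacyc : (M.remainingGraph hloop hR).IsAcyclic) :
    Nat.card E + 2 ≤ 2 * Nat.card M.Vertex + R.card := by
  classical
  have := Fintype.ofFinite E
  have : Finite M.Vertex := inferInstanceAs (Finite (Quotient _))
  have := Fintype.ofFinite M.Vertex
  have : Nonempty M.Vertex := M.nonempty.map M.tail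
  have h1 := hacyc.card_edgeFinset_lt
  have h2 := (M.remainingGraph hloop hR).dart_card_eq_twice_card_edges
  let F : {e // e ∉ R} → (M.remainingGraph hloop hR).Dart := fun e =>
    ⟨(M.tail e.1, M.head e.1), e.1, e.2, rfl, rfl⟩
  have inj : Function.Injective F := by
    intro e e' h
    have h' := congrArg SimpleGraph.Dart.toProd h
    exact Subtype.ext (hsimple _ _ (congrArg Prod.fst h') (congrArg Prod.snd h'))
  have h3 := Fintype.card_le_of_injective F inj
  have h4 : Fintype.card {e // e ∉ R} + R.card = Fintype.card E := by
    rw [Fintype.card_subtype_compl, Fintype.card_coe]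
    have := R.card_le_univ
    omega
  rw [Nat.card_eq_fintype_card, Nat.card_eq_fintype_card]
  omega

/-- On a map with simple graph and Euler characteristic less than `2`, at any stage of the growth of a
disk, some labelling by elements of a given non-commutative group is flat except at the growing face.
By induction the disk may be taken to be the whole surface; there, interlaced edges give the
labelling, and without them the remaining graph would be acyclic, hence have too many vertices. -/
theorem IsDisk.exists_isFlatExceptAt [Finite E] (hloop : ∀ e, M.tail e ≠ M.head e)
    (hsimple : ∀ e e', M.tail e = M.tail e' → M.head e = M.head e' → e = e')
    (hχ : M.eulerChar < 2) {G : Type v} [Group G] {p q : G} (hpq : p * q ≠ q * p)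
    {R : Finset E} {f : Equiv.Perm E} {x : E} {A : Finset M.Face} (h : M.IsDisk R f x A) :
    ∃ l : E → G, IsFlatExceptAt M.rev f l x := by
  classical
  induction hm : Nat.card E - R.card using Nat.strong_induction_on generalizing R f x A with
  | _ m ih =>
  by_cases hc : ∃ d, f.SameCycle x (M.rev d) ∧ ¬ f.SameCycle x d
  · obtain ⟨d, hd', hd⟩ := hc
    obtain ⟨R', f', x', A', h', hlt, hback⟩ := h.exists_step hloop hd' hd (G := G)
    refine hback (ih _ ?_ h' rfl)
    have := Fintype.ofFinite E
    have := R'.card_le_univ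
    rw [← Nat.card_eq_fintype_card] at this
    omega
  push Not at hc
  have hc' : ∀ y, f.SameCycle x y → f.SameCycle x (M.rev y) := fun y hy =>
    hc _ (by rwa [M.rev_rev])
  have hall := h.mem_or_sameCycle hc'
  have hcyc : ∀ e, e ∉ R → ∀ y, f.SameCycle e y ↔ f.SameCycle x y := fun e he y =>
    ⟨((hall e).resolve_left he).trans, ((hall e).resolve_left he).symm.trans⟩
  by_contra hno
  have hside : ∀ e, e ∉ R → ∃ U : Set E, e ∉ U ∧ M.rev e ∈ U ∧
      (∀ y ∈ U, (M.rev * f⁻¹) y ∈ U) ∧ ∀ y ∈ U, y ≠ M.rev e → M.rev y ∈ U := by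
    intro e he
    refine (exists_side_or_interlaced (e := e) (f := f) M.rev_rev M.rev_ne
      (by simpa only [hcyc e he] using hc') hpq).resolve_right ?_
    rintro ⟨l, hl1, hl2, hl3⟩
    simp only [hcyc e he] at hl2
    refine hno ⟨l, hl1, ?_, ?_⟩
    · rintro ⟨k, hk⟩
      exact hl3 ⟨k, by simpa only [hcyc e he] using hk⟩
    · intro y hy
      refine ⟨fun _ => 1, fun z hz => ?_⟩
      rw [hl2 z fun e => hy (e.trans hz.symm), mul_one]
  -- Hence every remaining edge is a bridge.
  have hacyc : (M.remainingGraph hloop h.rev_mem).IsAcyclic := by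
    rw [SimpleGraph.isAcyclic_iff_forall_adj_isBridge]
    rintro _ _ ⟨e, he, rfl, rfl⟩
    obtain ⟨U, hU1, hU2, hU3, hU4⟩ := hside e he
    rw [SimpleGraph.isBridge_iff]
    rintro ⟨w⟩
    -- `W` holds at the vertices on the side of the head of `e`; no other remaining edge leaves it.
    let W : M.Vertex → Prop := fun v => ∃ y ∈ U, y ∉ R ∧ M.tail y = v
    have hW : ∀ y, y ∉ R → (W (M.tail y) ↔ y ∈ U) := by
      intro y hy
      refine ⟨?_, fun hyU => ⟨y, hyU, hy, rfl⟩⟩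
      rintro ⟨z, hzU, hz, hzy⟩
      exact Equiv.Perm.SameCycle.of_forall_imp (p := fun y => y ∈ U) hU3
        (h.sameCycle_rot z y hz hy (tail_eq_iff.1 hzy)) hzU
    have hrevR : ∀ y, y ∉ R → M.rev y ∉ R := fun y hy => by rwa [h.rev_mem]
    have hstep : ∀ u v, ((M.remainingGraph hloop h.rev_mem).deleteEdges
        {s(M.tail e, M.head e)}).Adj u v → (W u ↔ W v) := by
      intro u v huv
      rw [SimpleGraph.deleteEdges_adj] at huv
      obtain ⟨⟨y, hy, rfl, rfl⟩, hne⟩ := huv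
      have n1 : y ≠ e := by rintro rfl; exact hne rfl
      have n2 : y ≠ M.rev e := by
        rintro rfl
        apply hne
        simp only [head, M.rev_rev]
        exact Sym2.eq_swap
      rw [hW y hy, head, hW _ (hrevR y hy)]
      refine ⟨fun hyU => hU4 y hyU n2, fun hyU => ?_⟩
      have := hU4 _ hyU fun e' => n1 (M.rev.injective e')
      rwa [M.rev_rev] at this
    have hwalk : ∀ u v, ((M.remainingGraph hloop h.rev_mem).deleteEdges
        {s(M.tail e, M.head e)}).Walk u v → (W u ↔ W v) := by
      intro u v w
      induction w with
      | nil => rfl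
      | cons huv _ ih => exact (hstep _ _ huv).trans ih
    have := hwalk _ _ w
    rw [hW e he, head, hW _ (hrevR e he)] at this
    exact hU1 (this.2 hU2)
  have hV := card_lt_card_vertex_of_isAcyclic hloop hsimple h.rev_mem hacyc
  have hF : A.card ≤ Nat.card M.Face := by
    have : Finite M.Face := inferInstanceAs (Finite (Quotient _))
    have := Fintype.ofFinite M.Face
    rw [Nat.card_eq_fintype_card]
    exact A.card_le_univ
  have hE := M.two_mul_card_edge_le
  have hA := h.card_faces
  rw [eulerChar] at hχ
  omega

end SurfaceMap

/-! ### Coherence in coordinates -/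

section Projective

variable {D : Type v} [DivisionRing D] {n : ℕ}

theorem ProjHyperplane.exists_functional (H : ProjHyperplane D n) :
    ∃ l : (Fin (n + 1) → D) →ₗ[D] D, LinearMap.ker l = H.1 := by
  have h1 := H.1.finrank_quotient_add_finrank
  rw [H.2, Module.finrank_fin_fun, add_comm] at h1
  obtain ⟨e⟩ := FiniteDimensional.nonempty_linearEquiv_of_finrank_eq (R := D)
    (M := (Fin (n + 1) → D) ⧸ H.1) (M' := D) (by rw [Module.finrank_self]; omega)
  refine ⟨e.toLinearMap ∘ₗ H.1.mkQ, ?_⟩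
  rw [LinearEquiv.ker_comp, Submodule.ker_mkQ]

theorem finrank_ker_of_ne_zero {l : (Fin (n + 1) → D) →ₗ[D] D} {x : Fin (n + 1) → D}
    (hx : l x ≠ 0) : Module.finrank D (LinearMap.ker l) = n := by
  have h1 := l.finrank_range_add_finrank_ker
  have h2 : LinearMap.range l = ⊤ := by
    rw [LinearMap.range_eq_top]
    intro c
    exact ⟨(c * (l x)⁻¹) • x, by rw [map_smul, smul_eq_mul, mul_assoc, inv_mul_cancel₀ hx, mul_one]⟩
  rw [h2, finrank_top, Module.finrank_self, Module.finrank_fin_fun] at h1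
  omega

theorem ProjPoint.liesOn_iff {A : ProjPoint D n} {H : ProjHyperplane D n}
    {l : (Fin (n + 1) → D) →ₗ[D] D} (hl : LinearMap.ker l = H.1) {a : Fin (n + 1) → D}
    (ha : A.submodule = Submodule.span D {a}) : A.LiesOn H ↔ l a = 0 := by
  rw [ProjPoint.LiesOn, ha, ← hl, Submodule.span_singleton_le_iff_mem, LinearMap.mem_ker]

/-- In coordinates, coherence is the vanishing of a `2 × 2` determinant over the division ring,
written as a trivial multiplicative holonomy. -/
theorem coherent_iff {A₁ A₂ : ProjPoint D n} {H₁ H₂ : ProjHyperplane D n}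
    {l₁ l₂ : (Fin (n + 1) → D) →ₗ[D] D} (hl₁ : LinearMap.ker l₁ = H₁.1)
    (hl₂ : LinearMap.ker l₂ = H₂.1) {a₁ a₂ : Fin (n + 1) → D}
    (ha₁ : A₁.submodule = Submodule.span D {a₁}) (ha₂ : A₂.submodule = Submodule.span D {a₂})
    (h11 : l₁ a₁ ≠ 0) :
    Coherent A₁ A₂ H₁ H₂ ↔ l₂ a₂ = l₁ a₂ * (l₁ a₁)⁻¹ * l₂ a₁ := by
  -- `b` is the point of the line `A₁A₂` on `H₁`.
  set b := a₂ - (l₁ a₂ * (l₁ a₁)⁻¹) • a₁ with hb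
  have hb1 : l₁ b = 0 := by
    rw [hb, map_sub, map_smul, smul_eq_mul, mul_assoc, inv_mul_cancel₀ h11, mul_one, sub_self]
  have hb2 : l₂ b = 0 ↔ l₂ a₂ = l₁ a₂ * (l₁ a₁)⁻¹ * l₂ a₁ := by
    rw [hb, map_sub, map_smul, smul_eq_mul, sub_eq_zero]
  constructor
  · rintro (h | h | ⟨B, hB, hB1, hB2⟩)
    · have : a₂ ∈ Submodule.span D {a₁} := by
        rw [← ha₁, h, ha₂]; exact Submodule.mem_span_singleton_self _
      obtain ⟨c, rfl⟩ := Submodule.mem_span_singleton.1 this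
      simp only [map_smul, smul_eq_mul]
      rw [mul_assoc c, mul_inv_cancel₀ h11, mul_one]
    · rw [← hb2, ← LinearMap.mem_ker, hl₂, ← h, ← hl₁]
      exact hb1
    · have hBs : B.submodule = Submodule.span D {B.rep} := by
        conv_lhs => rw [← B.mk_rep]
        rw [Projectivization.submodule_mk]
      rw [ProjPoint.liesOn_iff hl₁ hBs] at hB1
      rw [ProjPoint.liesOn_iff hl₂ hBs] at hB2
      have hmem : B.rep ∈ A₁.submodule ⊔ A₂.submodule :=
        hB (hBs ▸ Submodule.mem_span_singleton_self _)
      rw [ha₁, ha₂, Submodule.mem_sup] at hmem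
      obtain ⟨_, hy, _, hz, hyz⟩ := hmem
      obtain ⟨c, rfl⟩ := Submodule.mem_span_singleton.1 hy
      obtain ⟨c', rfl⟩ := Submodule.mem_span_singleton.1 hz
      have hrep : B.rep = c' • b + ((c' * (l₁ a₂ * (l₁ a₁)⁻¹)) + c) • a₁ := by
        rw [← hyz, hb, smul_sub, add_smul, mul_smul c' (l₁ a₂ * (l₁ a₁)⁻¹)]; abel
      rw [hrep, map_add, map_smul, map_smul, hb1, smul_zero, zero_add, smul_eq_mul,
        mul_eq_zero, or_iff_left h11] at hB1
      rw [hB1, zero_smul, add_zero] at hrep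
      have hc' : c' ≠ 0 := by
        rintro rfl
        exact B.rep_nonzero (by rw [hrep, zero_smul])
      rw [hrep, map_smul, smul_eq_mul, mul_eq_zero, or_iff_right hc'] at hB2
      exact hb2.1 hB2
  · intro h
    by_cases hb0 : b = 0
    · left
      have h2 : a₂ = (l₁ a₂ * (l₁ a₁)⁻¹) • a₁ := sub_eq_zero.1 (hb ▸ hb0)
      have h0 : l₁ a₂ * (l₁ a₁)⁻¹ ≠ 0 := by
        intro e
        rw [e, zero_smul] at h2
        have : A₂.submodule = ⊥ := by rw [ha₂, h2, Submodule.span_zero_singleton]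
        have hr := A₂.finrank_submodule
        rw [this, finrank_bot] at hr
        exact zero_ne_one hr
      apply Projectivization.submodule_injective
      rw [ha₁, ha₂, h2, Submodule.span_singleton_smul_eq (IsUnit.mk0 _ h0)]
    · refine Or.inr (Or.inr ⟨Projectivization.mk D b hb0, ?_, ?_, ?_⟩)
      · rw [Projectivization.submodule_mk, Submodule.span_singleton_le_iff_mem, ha₁, ha₂, hb]
        exact sub_mem (Submodule.mem_sup_right (Submodule.mem_span_singleton_self _))
          (Submodule.mem_sup_left (Submodule.smul_mem _ _ (Submodule.mem_span_singleton_self _)))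
      · rw [ProjPoint.liesOn_iff hl₁ (Projectivization.submodule_mk _ _)]
        exact hb1
      · rw [ProjPoint.liesOn_iff hl₂ (Projectivization.submodule_mk _ _)]
        exact hb2.2 h

theorem Coherent.swap_points {A₁ A₂ : ProjPoint D n} {H₁ H₂ : ProjHyperplane D n}
    (h : Coherent A₁ A₂ H₁ H₂) : Coherent A₂ A₁ H₁ H₂ := by
  rcases h with h | h | ⟨B, h1, h2, h3⟩
  · exact Or.inl h.symm
  · exact Or.inr (Or.inl h)
  · exact Or.inr (Or.inr ⟨B, by rwa [sup_comm], h2, h3⟩)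

theorem Coherent.swap_planes {A₁ A₂ : ProjPoint D n} {H₁ H₂ : ProjHyperplane D n}
    (h : Coherent A₁ A₂ H₁ H₂) : Coherent A₁ A₂ H₂ H₁ := by
  rcases h with h | h | ⟨B, h1, h2, h3⟩
  · exact Or.inl h
  · exact Or.inr (Or.inl h.symm)
  · exact Or.inr (Or.inr ⟨B, h1, h3, h2⟩)

/-- Over an infinite division ring there are arbitrarily many vectors in general position. -/
theorem exists_generalPosition [Infinite D] (B : Type*) [Finite B] (n : ℕ) :
    ∃ a : B → Fin (n + 1) → D, ∀ t : Set B, t.ncard ≤ n + 1 → LinearIndepOn D a t := by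
  classical
  have := Fintype.ofFinite B
  suffices H : ∀ s : Finset B, ∃ a : B → Fin (n + 1) → D,
      ∀ t : Set B, t ⊆ s → t.ncard ≤ n + 1 → LinearIndepOn D a t by
    obtain ⟨a, ha⟩ := H Finset.univ
    exact ⟨a, fun t ht => ha t (by simp) ht⟩
  intro s
  induction s using Finset.induction_on with
  | empty =>
    refine ⟨0, fun t ht _ => ?_⟩
    rw [Finset.coe_empty, Set.subset_empty_iff] at ht
    subst ht
    exact linearIndepOn_empty _ _
  | insert b s hb ih =>
    obtain ⟨a, ha⟩ := ih
    -- The new vector avoids the spans of at most `n` of the old ones.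
    let S : Finset (Subspace D (Fin (n + 1) → D)) :=
      (s.powerset.filter fun t => t.card ≤ n).image
        fun t : Finset B => Submodule.span D (a '' (t : Set B))
    have hS : ⊤ ∉ S := by
      intro h
      obtain ⟨t, ht, h⟩ := Finset.mem_image.1 h
      have h1 : Module.finrank D (Submodule.span D (a '' (t : Set B))) ≤ t.card := by
        rw [← Finset.coe_image]
        exact (finrank_span_finset_le_card _).trans Finset.card_image_le
      have h2 := (Finset.mem_filter.1 ht).2
      rw [h, finrank_top, Module.finrank_fin_fun] at h1
      omega
    obtain ⟨v, hv⟩ := (Set.ne_univ_iff_exists_notMem _).1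
      (Subspace.biUnion_ne_univ_of_top_notMem hS)
    have ha' : ∀ t : Set B, b ∉ t → Set.EqOn (Function.update a b v) a t := fun t hbt x hx =>
      Function.update_of_ne (by rintro rfl; exact hbt hx) _ _
    refine ⟨Function.update a b v, fun t ht hcard => ?_⟩
    by_cases hbt : b ∈ t
    · obtain ⟨t', hbt', rfl⟩ : ∃ t', b ∉ t' ∧ t = insert b t' :=
        ⟨t \ {b}, by simp, by simp [Set.insert_eq_of_mem hbt]⟩
      rw [Set.ncard_insert_of_notMem hbt'] at hcard
      have hts : t' ⊆ s := by
        intro x hx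
        have := ht (Set.mem_insert_of_mem _ hx)
        simp only [Finset.coe_insert, Set.mem_insert_iff] at this
        exact this.resolve_left (by rintro rfl; exact hbt' hx)
      rw [linearIndepOn_insert hbt', Function.update_self, (ha' t' hbt').image_eq,
        linearIndepOn_congr (ha' t' hbt')]
      refine ⟨ha t' hts (by omega), fun hmem => hv ?_⟩
      refine Set.mem_biUnion (x := Submodule.span D (a '' t')) ?_ hmem
      refine Finset.mem_coe.2 (Finset.mem_image.2 ⟨t'.toFinset, ?_, by simp⟩)
      rw [Finset.mem_filter, Finset.mem_powerset, ← Set.ncard_eq_toFinset_card']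
      exact ⟨fun x hx => hts (Set.mem_toFinset.1 hx), by omega⟩
    · rw [linearIndepOn_congr (ha' t hbt)]
      refine ha t ?_ hcard
      intro x hx
      have := ht hx
      simp only [Finset.coe_insert, Set.mem_insert_iff] at this
      exact this.resolve_left (by rintro rfl; exact hbt hx)

/-- A functional may take prescribed values at independent vectors. -/
theorem LinearIndepOn.exists_functional {B V : Type*} [AddCommGroup V] [Module D V] {a : B → V}
    {t : Set B} (ht : LinearIndepOn D a t) (c : B → D) : ∃ l : V →ₗ[D] D, ∀ b ∈ t, l (a b) = c b := by
  obtain ⟨l, hl⟩ := ((Module.Basis.span ht).constr ℕ fun b => c b.1).exists_extend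
  refine ⟨l, fun b hb => ?_⟩
  have h1 := LinearMap.congr_fun hl (Module.Basis.span ht ⟨b, hb⟩)
  rw [Module.Basis.constr_basis] at h1
  rw [← h1]
  exact congrArg (fun z => l z.1) (Module.Basis.span_apply ht ⟨b, hb⟩).symm

end Projective

/-! ### Tiles and labellings -/

namespace QuadTiling

variable {E : Type u} (T : QuadTiling E)

theorem tail_ne_head (e : E) : T.tail e ≠ T.head e := fun h => by
  have := T.bicolored e
  rw [← h] at this
  tauto

theorem head_mem_black_iff (e : E) : T.head e ∈ T.black ↔ T.tail e ∉ T.black := by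
  have := T.bicolored e
  tauto

theorem tail_rev (e : E) : T.tail (T.rev e) = T.head e := rfl

theorem head_rev (e : E) : T.head (T.rev e) = T.tail e := by
  rw [SurfaceMap.head, T.rev_rev]

theorem tail_next_mem_black_iff (e : E) : T.tail (T.next e) ∈ T.black ↔ T.tail e ∉ T.black := by
  rw [SurfaceMap.tail_next, head_mem_black_iff]

theorem leftFace_next (e : E) : T.leftFace (T.next e) = T.leftFace e :=
  SurfaceMap.leftFace_eq_iff.2 (Equiv.Perm.sameCycle_apply_left.2 (.refl _ _))

theorem exists_black_dart (t : T.Face) : ∃ e, T.leftFace e = t ∧ T.tail e ∈ T.black := by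
  obtain ⟨e, rfl⟩ := Quotient.exists_rep t
  by_cases h : T.tail e ∈ T.black
  · exact ⟨e, rfl, h⟩
  · exact ⟨T.next e, T.leftFace_next e, (T.tail_next_mem_black_iff e).2 h⟩

section Tiles

variable [Finite E]

theorem minimalPeriod_next (e : E) : Function.minimalPeriod T.next e = 4 := by
  rw [← T.four_sides (T.leftFace e), SurfaceMap.sides]
  let F : Fin (Function.minimalPeriod T.next e) → {y // T.leftFace y = T.leftFace e} := fun i =>
    ⟨(T.next ^ i.1) e, SurfaceMap.leftFace_eq_iff.2 (Equiv.Perm.sameCycle_pow_left.2 (.refl _ _))⟩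
  have hF : Function.Bijective F := by
    constructor
    · intro i j h
      exact Fin.ext (Equiv.Perm.pow_apply_inj_of_lt i.2 j.2 (congrArg Subtype.val h))
    · rintro ⟨y, hy⟩
      obtain ⟨i, hi, h⟩ :=
        (SurfaceMap.leftFace_eq_iff.1 hy).symm.exists_lt_minimalPeriod
      exact ⟨⟨i, hi⟩, Subtype.ext h⟩
  rw [← Nat.card_eq_of_bijective F hF, Nat.card_fin]

theorem next_next_next_next (e : E) : T.next (T.next (T.next (T.next e))) = e := by
  have := T.next.pow_minimalPeriod_apply e
  rwa [T.minimalPeriod_next] at this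

theorem leftFace_eq_iff_mem {e y : E} : T.leftFace y = T.leftFace e ↔
    y = e ∨ y = T.next e ∨ y = T.next (T.next e) ∨ y = T.next (T.next (T.next e)) := by
  constructor
  · intro h
    obtain ⟨i, hi, rfl⟩ := (SurfaceMap.leftFace_eq_iff.1 h).symm.exists_lt_minimalPeriod
    rw [T.minimalPeriod_next] at hi
    interval_cases i <;> simp [pow_succ]
  · rintro (rfl | rfl | rfl | rfl) <;> simp only [leftFace_next]

theorem pow_next_ne (e : E) {i : ℕ} (hi : 0 < i) (hi' : i < 4) : (T.next ^ i) e ≠ e := fun h =>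
  hi.ne' (Equiv.Perm.pow_apply_inj_of_lt (f := T.next) (e := e) (j := 0)
    (by rwa [T.minimalPeriod_next]) (by rw [T.minimalPeriod_next]; omega) h)

theorem next_next_ne (e : E) : T.next (T.next e) ≠ e :=
  T.pow_next_ne e (i := 2) (by omega) (by omega)

/-- The holonomy of a labelling around the tile to the left of `e`, read from `e`. -/
def holonomy {G : Type*} [Mul G] (l : E → G) (e : E) : G :=
  l e * l (T.next e) * l (T.next (T.next e)) * l (T.next (T.next (T.next e)))

theorem isFlatAt_iff_holonomy_eq_one {G : Type v} [Group G] (l : E → G) (e : E) :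
    IsFlatAt T.next l e ↔ T.holonomy l e = 1 := by
  have c0 : T.next.SameCycle e e := .refl _ _
  have c1 := Equiv.Perm.sameCycle_apply_right.2 c0
  have c2 := Equiv.Perm.sameCycle_apply_right.2 c1
  have c3 := Equiv.Perm.sameCycle_apply_right.2 c2
  have h4 := T.next_next_next_next e
  constructor
  · rintro ⟨h, hh⟩
    have e4 := hh _ c3
    rw [h4, hh _ c2, hh _ c1, hh _ c0] at e4
    have : h e * T.holonomy l e = h e * 1 := by
      rw [mul_one, holonomy]
      conv_rhs => rw [e4]
      simp only [mul_assoc]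
    exact mul_left_cancel this
  · intro hl
    set d := T.next (T.next (T.next e)) with hd
    obtain ⟨h, hh⟩ := exists_developing_of_ne T.next l d
    have n0 : e ≠ d := (T.pow_next_ne e (i := 3) (by omega) (by omega)).symm
    have n1 : T.next e ≠ d := (T.next_next_ne (T.next e)).symm
    have n2 : T.next (T.next e) ≠ d :=
      (T.pow_next_ne (T.next (T.next e)) (i := 1) (by omega) (by omega)).symm
    refine ⟨h, fun y hy => ?_⟩
    by_cases hyd : y = d
    · have e3 : h d = h e * l e * l (T.next e) * l (T.next (T.next e)) := by
        rw [hd, hh _ (c3.symm.trans c2) n2, hh _ (c3.symm.trans c1) n1, hh _ c3.symm n0]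
      rw [hyd, h4, e3]
      have : h e * T.holonomy l e = h e := by rw [hl, mul_one]
      rw [holonomy] at this
      conv_lhs => rw [← this]
      simp only [mul_assoc, hd]
    · exact hh y (c3.symm.trans hy) hyd

end Tiles

/-! ### Realizations and labellings -/

variable {T} {D : Type v} [DivisionRing D] {n : ℕ}

/-- `l` labels the darts of `T` by the values of the functionals defining the hyperplanes of `R` at
vectors representing the points of `R`, with inverse labels on the darts leaving white vertices. -/
def Realization.IsLabelling (R : T.Realization D n) (l : E → Dˣ) : Prop :=
  (∀ e, l (T.rev e) = (l e)⁻¹) ∧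
  ∃ (a : T.BlackVertex → Fin (n + 1) → D) (L : T.WhiteVertex → (Fin (n + 1) → D) →ₗ[D] D),
    (∀ b, (R.point b).submodule = Submodule.span D {a b}) ∧
    (∀ w, LinearMap.ker (L w) = (R.plane w).1) ∧
    ∀ e b w, T.tail e = b.1 → T.head e = w.1 → (l e : D) = L w (a b)

theorem Realization.exists_isLabelling (R : T.Realization D n) :
    ∃ l : E → Dˣ, R.IsLabelling l := by
  classical
  choose L hL using fun w => (R.plane w).exists_functional
  have ha : ∀ b, (R.point b).submodule = Submodule.span D {(R.point b).rep} := fun b => by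
    conv_lhs => rw [← (R.point b).mk_rep]
    rw [Projectivization.submodule_mk]
  have hne : ∀ e b w, T.tail e = b.1 → T.head e = w.1 → L w (R.point b).rep ≠ 0 :=
    fun e b w hb hw h0 => R.not_incident e b w hb hw ((ProjPoint.liesOn_iff (hL w) (ha b)).2 h0)
  let m : (e : E) → T.tail e ∈ T.black → Dˣ := fun e he =>
    Units.mk0 _ (hne e ⟨_, he⟩ ⟨T.head e, (T.bicolored e).1 he⟩ rfl rfl)
  have hrev : ∀ e, T.tail e ∉ T.black → T.tail (T.rev e) ∈ T.black := fun e he =>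
    (T.head_mem_black_iff e).2 he
  refine ⟨fun e => if he : T.tail e ∈ T.black then m e he else (m (T.rev e) (hrev e he))⁻¹,
    ?_, fun b => (R.point b).rep, L, ha, hL, ?_⟩
  · intro e
    by_cases he : T.tail e ∈ T.black
    · have he' : T.tail (T.rev e) ∉ T.black := (T.bicolored e).1 he
      simp only [dif_pos he, dif_neg he', T.rev_rev]
    · simp only [dif_neg he, dif_pos (hrev e he), inv_inv]
  · rintro e ⟨b, hb⟩ ⟨w, hw⟩ rfl rfl
    simp only [dif_pos hb, m, Units.val_mk0]

variable [Finite E]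

/-- A tile is coherent if and only if the holonomy around it is trivial. -/
theorem Realization.IsLabelling.tileCoherent_iff {R : T.Realization D n} {l : E → Dˣ}
    (hl : R.IsLabelling l) {e : E} (he : T.tail e ∈ T.black) :
    R.TileCoherent (T.leftFace e) ↔ T.holonomy l e = 1 := by
  obtain ⟨hinv, a, L, ha, hL, hla⟩ := hl
  have k1 : T.tail (T.next e) ∉ T.black := fun h => (T.tail_next_mem_black_iff e).1 h he
  have k2 : T.tail (T.next (T.next e)) ∈ T.black := (T.tail_next_mem_black_iff _).2 k1
  have k3 : T.tail (T.next (T.next (T.next e))) ∉ T.black := fun h =>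
    (T.tail_next_mem_black_iff _).1 h k2
  have f1 := T.leftFace_next e
  have f2 := (T.leftFace_next (T.next e)).trans f1
  have f3 := (T.leftFace_next (T.next (T.next e))).trans f2
  let b₁ : T.BlackVertex := ⟨_, he⟩
  let b₂ : T.BlackVertex := ⟨_, k2⟩
  let w₁ : T.WhiteVertex := ⟨_, k1⟩
  let w₂ : T.WhiteVertex := ⟨_, k3⟩
  have m11 : (l e : D) = L w₁ (a b₁) := hla e b₁ w₁ rfl (SurfaceMap.tail_next e).symm
  have m22 : (l (T.next (T.next e)) : D) = L w₂ (a b₂) :=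
    hla _ b₂ w₂ rfl (SurfaceMap.tail_next _).symm
  have m21 : (((l (T.next e))⁻¹ : Dˣ) : D) = L w₁ (a b₂) := by
    rw [← hinv]
    exact hla _ b₂ w₁ ((T.tail_rev _).trans (SurfaceMap.tail_next _).symm) (T.head_rev _)
  have m12 : (((l (T.next (T.next (T.next e))))⁻¹ : Dˣ) : D) = L w₂ (a b₁) := by
    rw [← hinv]
    refine hla _ b₁ w₂ ((T.tail_rev _).trans ?_) (T.head_rev _)
    rw [← SurfaceMap.tail_next, T.next_next_next_next]
  have key : Coherent (R.point b₁) (R.point b₂) (R.plane w₁) (R.plane w₂) ↔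
      T.holonomy l e = 1 := by
    rw [coherent_iff (hL w₁) (hL w₂) (ha b₁) (ha b₂) (by rw [← m11]; exact (l e).ne_zero),
      ← m11, ← m22, ← m21, ← m12, ← Units.val_inv_eq_inv_val, ← Units.val_mul, ← Units.val_mul,
      Units.val_inj, holonomy]
    constructor
    · intro h; rw [h]; group
    · intro h
      rw [mul_eq_one_iff_eq_inv] at h
      rw [← h]; group
  rw [← key]
  constructor
  · intro h
    refine h b₁ b₂ w₁ w₂ ?_ ?_ ⟨e, rfl, rfl⟩ ⟨_, rfl, f2⟩ ⟨_, rfl, f1⟩ ⟨_, rfl, f3⟩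
    · intro h'
      exact T.next_next_ne e (T.subdivision.vertex_inj _ _ f2 (congrArg Subtype.val h').symm)
    · intro h'
      exact T.next_next_ne (T.next e)
        (T.subdivision.vertex_inj _ _ (f3.trans f1.symm) (congrArg Subtype.val h').symm)
  · intro h
    have hb : ∀ b : T.BlackVertex, T.IsVertexOf b.1 (T.leftFace e) → b = b₁ ∨ b = b₂ := by
      rintro ⟨_, hb⟩ ⟨y, rfl, hy⟩
      rcases T.leftFace_eq_iff_mem.1 hy with rfl | rfl | rfl | rfl
      · exact Or.inl rfl
      · exact (k1 hb).elim
      · exact Or.inr rfl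
      · exact (k3 hb).elim
    have hw : ∀ w : T.WhiteVertex, T.IsVertexOf w.1 (T.leftFace e) → w = w₁ ∨ w = w₂ := by
      rintro ⟨_, hw⟩ ⟨y, rfl, hy⟩
      rcases T.leftFace_eq_iff_mem.1 hy with rfl | rfl | rfl | rfl
      · exact (hw he).elim
      · exact Or.inl rfl
      · exact (hw k2).elim
      · exact Or.inr rfl
    intro c₁ c₂ v₁ v₂ hc hv hc₁ hc₂ hv₁ hv₂
    rcases hb c₁ hc₁ with rfl | rfl <;> rcases hb c₂ hc₂ with rfl | rfl <;>
      rcases hw v₁ hv₁ with rfl | rfl <;> rcases hw v₂ hv₂ with rfl | rfl <;>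
      first
        | exact (hc rfl).elim
        | exact (hv rfl).elim
        | exact h
        | exact h.swap_points
        | exact h.swap_planes
        | exact h.swap_points.swap_planes

/-- Over an infinite division ring, every labelling comes from a realization, provided that the
dimension is large enough for a hyperplane to be interpolated through the values prescribed at the
neighbours of each white vertex. -/
theorem exists_realization_isLabelling [Infinite D] (hsimple : T.IsSimple)
    (hn : ∀ w : T.WhiteVertex, T.degree w.1 ≤ n + 1) {l : E → Dˣ}
    (hl : ∀ e, l (T.rev e) = (l e)⁻¹) : ∃ R : T.Realization D n, R.IsLabelling l := by
  classical
  have : Finite T.Vertex := inferInstanceAs (Finite (Quotient _))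
  have : Finite T.BlackVertex := inferInstanceAs (Finite (Subtype _))
  obtain ⟨a, ha⟩ := exists_generalPosition (D := D) T.BlackVertex n
  have ha0 : ∀ b, a b ≠ 0 := fun b =>
    (ha {b} (by rw [Set.ncard_singleton]; omega)).ne_zero rfl
  have hw : ∀ w : T.WhiteVertex, ∃ L : (Fin (n + 1) → D) →ₗ[D] D,
      ∀ e b, T.tail e = b.1 → T.head e = w.1 → (l e : D) = L (a b) := by
    intro w
    let N : {e // T.tail e = w.1} → T.BlackVertex := fun e =>
      ⟨T.head e.1, (T.head_mem_black_iff e.1).2 (e.2.symm ▸ w.2)⟩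
    have hN : (Set.range N).ncard ≤ n + 1 := by
      refine le_trans ?_ (hn w)
      rw [SurfaceMap.degree, ← Nat.card_coe_set_eq]
      exact Finite.card_range_le N
    obtain ⟨L, hL⟩ := (ha _ hN).exists_functional fun b =>
      if h : ∃ e, T.tail e = b.1 ∧ T.head e = w.1 then (l h.choose : D) else 0
    refine ⟨L, fun e b hb hw => ?_⟩
    have hex : ∃ e, T.tail e = b.1 ∧ T.head e = w.1 := ⟨e, hb, hw⟩
    rw [hL b ⟨⟨T.rev e, hw⟩, Subtype.ext ((T.head_rev e).trans hb)⟩, dif_pos hex]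
    rw [hsimple hex.choose e (hex.choose_spec.1.trans hb.symm) (hex.choose_spec.2.trans hw.symm)]
  choose L hL using hw
  have hker : ∀ w, Module.finrank D (LinearMap.ker (L w)) = n := by
    rintro ⟨w, hw⟩
    obtain ⟨e, rfl⟩ := Quotient.exists_rep w
    have hb : T.head e ∈ T.black := (T.head_mem_black_iff e).2 hw
    refine finrank_ker_of_ne_zero (x := a ⟨_, hb⟩) ?_
    rw [← hL ⟨_, hw⟩ (T.rev e) ⟨_, hb⟩ rfl (T.head_rev e)]
    exact (l _).ne_zero
  have hspan : ∀ b, (Projectivization.mk D (a b) (ha0 b)).submodule = Submodule.span D {a b} :=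
    fun b => Projectivization.submodule_mk _ _
  refine ⟨⟨fun b => Projectivization.mk D (a b) (ha0 b), fun w => ⟨LinearMap.ker (L w), hker w⟩,
    ?_⟩, hl, a, L, hspan, fun w => rfl, fun e b w hb hw => hL w e b hb hw⟩
  intro e b w hb hw
  rw [ProjPoint.liesOn_iff (H := ⟨LinearMap.ker (L w), hker w⟩) rfl (hspan b), ← hL w e b hb hw]
  exact (l e).ne_zero

/-! ### The two implications -/

/-- Over a field, the product of the holonomies of all tiles is the product of all labels, in which
the two orientations of each edge cancel. -/
theorem incidenceTheorem_of_commutative (T : QuadTiling E) (n : ℕ) (hD : ∀ a b : D, a * b = b * a) :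
    T.IncidenceTheorem D n := by
  classical
  have := Fintype.ofFinite E
  have : Finite T.Face := inferInstanceAs (Finite (Quotient _))
  have := Fintype.ofFinite T.Face
  let _ : CommGroup Dˣ :=
    { (inferInstance : Group Dˣ) with mul_comm := fun a b => Units.ext (hD a b) }
  intro R t₀ ht
  obtain ⟨l, hl⟩ := R.exists_isLabelling
  have hprod : ∏ e, l e = 1 := by
    refine Finset.prod_involution (fun e _ => T.rev e) ?_ ?_ ?_ ?_
    · intro e _; rw [hl.1, mul_inv_cancel]
    · intro e _ _; exact T.rev_ne e
    · intro e _; exact Finset.mem_univ _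
    · intro e _; exact T.rev_rev e
  have hface : ∀ e, ∏ y with T.leftFace y = T.leftFace e, l y = T.holonomy l e := by
    intro e
    have p1 := fun e => T.pow_next_ne e (i := 1) (by omega) (by omega)
    have p2 := T.next_next_ne
    have p3 := fun e => T.pow_next_ne e (i := 3) (by omega) (by omega)
    have : (Finset.univ.filter fun y => T.leftFace y = T.leftFace e) =
        {e, T.next e, T.next (T.next e), T.next (T.next (T.next e))} := by
      ext y
      simp only [Finset.mem_filter, Finset.mem_univ, true_and, Finset.mem_insert,
        Finset.mem_singleton, T.leftFace_eq_iff_mem]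
    rw [this, Finset.prod_insert, Finset.prod_insert, Finset.prod_insert, Finset.prod_singleton,
      holonomy]
    · simp only [mul_assoc]
    · simpa using (p1 (T.next (T.next e))).symm
    · simp only [Finset.mem_insert, Finset.mem_singleton, not_or]
      exact ⟨(p1 (T.next e)).symm, (p2 (T.next e)).symm⟩
    · simp only [Finset.mem_insert, Finset.mem_singleton, not_or]
      exact ⟨(p1 e).symm, (p2 e).symm, (p3 e).symm⟩
  obtain ⟨e₀, rfl, he₀⟩ := T.exists_black_dart t₀
  rw [hl.tileCoherent_iff he₀, ← hface]
  rw [← Finset.prod_fiberwise Finset.univ T.leftFace l] at hprod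
  rwa [Finset.prod_eq_single (T.leftFace e₀)] at hprod
  · intro t _ hne
    obtain ⟨e, rfl, he⟩ := T.exists_black_dart t
    rw [hface, ← hl.tileCoherent_iff he]
    exact ht _ hne
  · intro h; exact (h (Finset.mem_univ _)).elim

theorem not_incidenceTheorem_of_noncommutative (hsimple : T.IsSimple) (hχ : T.eulerChar < 2)
    (hn : ∀ w : T.WhiteVertex, T.degree w.1 ≤ n + 1) {p q : D} (hpq : p * q ≠ q * p) :
    ¬ T.IncidenceTheorem D n := by
  -- A finite division ring is commutative, so `D` is infinite.
  have : Infinite D := by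
    by_contra h
    rw [not_infinite_iff_finite] at h
    exact hpq ((Finite.isDomain_to_isField D).mul_comm p q)
  have hp : p ≠ 0 := by rintro rfl; simp at hpq
  have hq : q ≠ 0 := by rintro rfl; simp at hpq
  have hpq' : Units.mk0 p hp * Units.mk0 q hq ≠ Units.mk0 q hq * Units.mk0 p hp := fun h =>
    hpq (congrArg Units.val h)
  obtain ⟨x⟩ := T.nonempty
  obtain ⟨l, hl⟩ := (T.isDisk_next x).exists_isFlatExceptAt T.tail_ne_head hsimple hχ hpq'
  obtain ⟨R, hR⟩ := exists_realization_isLabelling (n := n) hsimple hn hl.map_inv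
  intro hT
  obtain ⟨e₀, h₀, he₀⟩ := T.exists_black_dart (T.leftFace x)
  have h₀' : T.next.SameCycle x e₀ := (SurfaceMap.leftFace_eq_iff.1 h₀).symm
  have := hT R (T.leftFace x) fun t ht => by
    obtain ⟨e, rfl, he⟩ := T.exists_black_dart t
    rw [hR.tileCoherent_iff he, ← T.isFlatAt_iff_holonomy_eq_one]
    exact hl.flat e fun h => ht (SurfaceMap.leftFace_eq_iff.2 h.symm)
  rw [← h₀, hR.tileCoherent_iff he₀, ← T.isFlatAt_iff_holonomy_eq_one] at this
  obtain ⟨h, hh⟩ := this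
  exact hl.not_flat ⟨h, fun y hy => hh y (h₀'.symm.trans hy)⟩

end QuadTiling

theorem mainTheorem3 {E : Type u} [Finite E] (T : QuadTiling E) (hsimple : T.IsSimple)
    (g : ℕ) (hg : 0 < g) (hgenus : T.HasGenus g)
    (D : Type v) [DivisionRing D] (n : ℕ)
    (hn : ∀ w : T.WhiteVertex, T.degree w.1 ≤ n + 1) :
    T.IncidenceTheorem D n ↔ ∀ a b : D, a * b = b * a := by
  refine ⟨fun hT => ?_, T.incidenceTheorem_of_commutative n⟩
  have hχ : T.eulerChar < 2 := by
    rw [hgenus]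
    omega
  by_contra! h
  obtain ⟨p, q, hpq⟩ := h
  exact QuadTiling.not_incidenceTheorem_of_noncommutative hsimple hχ hn hpq hT
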